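/- Let $\mathbb D$ be the open unit disc, let $\mathcal H(\mathbb D)$ be the space of holomorphic functions on $\mathbb D$, and let $1<p<\infty$. For $f\in\mathcal H(\mathbb D)$ put $$\rho_{p,p}(f)=\left(\frac1{2\pi}\int_0^{2\pi}\int_0^1|f(re^{it})|^p\,dr\,dt\right)^{1/p},\qquad \rho_{p,\infty}(f)=\operatorname*{ess\,sup}_{t\in[0,2\pi)}\left(\int_0^1|f(re^{it})|^p\,dr\right)^{1/p}.$$ Let $A^p=\{f\in\mathcal H(\mathbb D):\rho_{p,p}(f)<\infty\}$ be the Bergman space, normed by $\rho_{p,p}$, let $RM(p,\infty)=\{f\in\mathcal H(\mathbb D):\rho_{p,\infty}(f)<\infty\}$, normed by $\rho_{p,\infty}$, and let $RM(p,0)$ be the subspace of $RM(p,\infty)$, with the same norm, of all $f$ such that $$\lim_{s\to1^-}\ \sup_{\theta}\left(\int_s^1|f(re^{i\theta})|^p\,dr\right)^{1/p}=0 .$$ Let $I:RM(p,0)\to A^p$ be the inclusion. **Theorem.** The second adjoint $I^{**}:(RM(p,0))^{**}\to (A^p)^{**}$ takes its values in the canonical image of $A^p$ in $(A^p)^{**}$.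 Regarded as a map $I^{**}:(RM(p,0))^{**}\to A^p$, it is continuous, linear and injective, and moreover 1. $I^{**}\big((RM(p,0))^{**}\big)=RM(p,\infty)$; 2. $I^{**}:(RM(p,0))^{**}\to RM(p,\infty)$ is an isometry, that is, $\rho_{p,\infty}(I^{**}m)=\|m\|$ for all $m\in(RM(p,0))^{**}$. If $(x_n)$ is a bounded sequence in $(RM(p,0))^{**}$ that converges to $0$ in the weak-$*$ topology, then $(I^{**}x_n)$ converges to $0$ uniformly on compact subsets of $\mathbb D$. -/

import Mathlib

open Filter Topology MeasureTheory Set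
open scoped ENNReal NNReal

noncomputable section

/-! ### The spaces `RM(p, q)` of average radial integrability

A function on the open unit disc `𝔻 = Metric.ball 0 1` is represented by the function `ℂ → ℂ` that
extends it by `0` outside the disc. -/

/-- `𝓗(𝔻)`: the holomorphic functions on the open unit disc, extended by zero. -/
def holDisc : Submodule ℂ (ℂ → ℂ) where
  carrier := {f | DifferentiableOn ℂ f (Metric.ball 0 1) ∧ ∀ z ∉ Metric.ball (0 : ℂ) 1, f z = 0}
  add_mem' hf hg := ⟨hf.1.add hg.1, fun z hz => by simp [hf.2 z hz, hg.2 z hz]⟩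
  zero_mem' := ⟨differentiableOn_const 0, fun _ _ => rfl⟩
  smul_mem' c _ hf := ⟨hf.1.const_smul c, fun z hz => by simp [hf.2 z hz]⟩

/-- `(∫_s^1 |f(r e^{iθ})|^p dr)^{1/p}`, for `p = ∞` the essential supremum of `|f(r e^{iθ})|` over
`s ≤ r < 1` (for continuous functions on the disc, this is the supremum). -/
def radialNorm (p : ℝ≥0∞) (f : ℂ → ℂ) (s θ : ℝ) : ℝ≥0∞ :=
  eLpNorm (fun r : ℝ => f (r * Complex.exp (θ * Complex.I))) p (volume.restrict (Ico s 1))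

/-- The probability measure `dt / 2π` on `[0, 2π)`. -/
def circleMeasure : Measure ℝ :=
  ENNReal.ofReal (1 / (2 * Real.pi)) • volume.restrict (Ico 0 (2 * Real.pi))

/-- `ρ_{p,q}(f)`: the `L^q(dt / 2π)`-norm of `t ↦ (∫_0^1 |f(r e^{it})|^p dr)^{1/p}`
(for `q = ∞` its essential supremum). -/
def rmNorm (p q : ℝ≥0∞) (f : ℂ → ℂ) : ℝ≥0∞ :=
  eLpNorm (fun t : ℝ => radialNorm p f 0 t) q circleMeasure

/-! Helper facts: `ρ_{p,q}` is a norm. -/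

lemma measurable_of_mem_holDisc {f : ℂ → ℂ} (hf : f ∈ holDisc) : Measurable f := by
  classical
  have h := (hf.1.continuousOn).measurable_piecewise (g := fun _ => (0 : ℂ))
    continuousOn_const Metric.isOpen_ball.measurableSet
  convert h using 1
  ext z
  by_cases hz : z ∈ Metric.ball (0 : ℂ) 1
  · simp only [Set.piecewise, hz, if_true]
  · simp only [Set.piecewise, hz, if_false, hf.2 z hz]

lemma measurable_polar :
    Measurable (fun x : ℝ × ℝ => (x.2 : ℂ) * Complex.exp (x.1 * Complex.I)) := by
  fun_prop

lemma measurable_ray {f : ℂ → ℂ} (hf : f ∈ holDisc) (θ : ℝ) :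
    Measurable (fun r : ℝ => f (r * Complex.exp (θ * Complex.I))) :=
  (measurable_of_mem_holDisc hf).comp (by fun_prop)

lemma polar_mem_ball {r θ : ℝ} (hr : r ∈ Ico (0 : ℝ) 1) :
    (r : ℂ) * Complex.exp (θ * Complex.I) ∈ Metric.ball (0 : ℂ) 1 := by
  simpa [Complex.norm_exp_ofReal_mul_I, abs_of_nonneg hr.1] using hr.2

lemma continuousOn_ray {f : ℂ → ℂ} (hf : f ∈ holDisc) (θ : ℝ) :
    ContinuousOn (fun r : ℝ => f (r * Complex.exp (θ * Complex.I))) (Ico 0 1) :=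
  hf.1.continuousOn.comp (by fun_prop) fun _ hr => polar_mem_ball hr

lemma radialNorm_top {f : ℂ → ℂ} (hf : f ∈ holDisc) (θ : ℝ) :
    radialNorm ∞ f 0 θ =
      ⨆ r : ℚ, ⨆ _ : (r : ℝ) ∈ Ico (0 : ℝ) 1, ‖f ((r : ℝ) * Complex.exp (θ * Complex.I))‖ₑ := by
  set g : ℝ → ℂ := fun r => f (r * Complex.exp (θ * Complex.I)) with hg
  have hc : ContinuousOn (fun r => ‖g r‖ₑ) (Ico 0 1) := (continuousOn_ray hf θ).enorm
  -- a bound on a dense part of `[0, 1)` extends to the right end of each small interval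
  have key : ∀ (M : ℝ≥0∞) (x : ℝ), x ∈ Ico (0 : ℝ) 1 → M < ‖g x‖ₑ →
      ∃ y, x < y ∧ y < 1 ∧ ∀ z ∈ Ioo x y, M < ‖g z‖ₑ := by
    intro M x hx hM
    have h1 : Tendsto (fun r => ‖g r‖ₑ) (𝓝[>] x) (𝓝 ‖g x‖ₑ) :=
      (hc x hx).mono_left (nhdsWithin_le_of_mem
        (mem_of_superset (Ioo_mem_nhdsGT hx.2) fun z hz => ⟨hx.1.trans hz.1.le, hz.2⟩))
    obtain ⟨y, hy, hy'⟩ := (mem_nhdsGT_iff_exists_Ioo_subset' hx.2).1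
      ((h1.eventually (lt_mem_nhds hM)))
    have hy0 : x < y := hy
    refine ⟨min y ((x + 1) / 2), lt_min hy0 (by linarith [hx.2]),
      (min_le_right _ _).trans_lt (by linarith [hx.2]), fun z hz => hy' ⟨hz.1, ?_⟩⟩
    exact hz.2.trans_le (min_le_left _ _)
  refine le_antisymm ?_ (iSup₂_le fun r hr => ?_)
  · rw [radialNorm, eLpNorm_exponent_top]
    refine essSup_le_of_ae_le _ ((ae_restrict_iff' measurableSet_Ico).2 (.of_forall fun x hx => ?_))
    by_contra hlt
    obtain ⟨y, hxy, hy1, hy⟩ := key _ x hx (not_le.1 hlt)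
    obtain ⟨s, hs1, hs2⟩ := exists_rat_btwn hxy
    have := hy s ⟨hs1, hs2⟩
    exact absurd this (not_lt.2 (le_iSup₂_of_le s ⟨hx.1.trans hs1.le, hs2.trans hy1⟩ le_rfl))
  · by_contra hlt
    obtain ⟨y, hxy, hy1, hy⟩ := key _ _ hr (not_le.1 hlt)
    have hae := (ae_restrict_iff' measurableSet_Ico).1
      (ae_le_eLpNormEssSup (f := g) (μ := volume.restrict (Ico (0 : ℝ) 1)))
    have h0 : volume (Ioo (r : ℝ) y) = 0 := by
      refine measure_mono_null (fun z hz => ?_) hae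
      intro hz'
      have h3 := hz' ⟨hr.1.trans hz.1.le, hz.2.trans hy1⟩
      have h2 := hy z hz
      rw [radialNorm, eLpNorm_exponent_top] at h2
      exact absurd h3 (not_le.2 h2)
    rw [Real.volume_Ioo, ENNReal.ofReal_eq_zero] at h0
    linarith

lemma measurable_radialNorm {f : ℂ → ℂ} (hf : f ∈ holDisc) (p : ℝ≥0∞) :
    Measurable (fun t : ℝ => radialNorm p f 0 t) := by
  have hm := (measurable_of_mem_holDisc hf).comp measurable_polar
  rcases eq_or_ne p 0 with rfl | h0
  · simp [radialNorm]
  rcases eq_or_ne p ∞ with rfl | hp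
  · simp_rw [radialNorm_top hf]
    refine Measurable.iSup fun r => Measurable.iSup fun _ => ?_
    exact ((measurable_of_mem_holDisc hf).comp (by fun_prop)).enorm
  · simp only [radialNorm, eLpNorm_eq_lintegral_rpow_enorm_toReal h0 hp]
    refine Measurable.pow_const ?_ _
    exact Measurable.lintegral_prod_right' (f := fun x : ℝ × ℝ =>
      ‖f ((x.2 : ℂ) * Complex.exp (x.1 * Complex.I))‖ₑ ^ p.toReal) (hm.enorm.pow_const _)

instance : IsProbabilityMeasure circleMeasure := by
  refine ⟨?_⟩
  rw [circleMeasure, Measure.smul_apply, Measure.restrict_apply_univ, Real.volume_Ico, smul_eq_mul,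
    ← ENNReal.ofReal_mul (by positivity), sub_zero, one_div,
    inv_mul_cancel₀ (by positivity), ENNReal.ofReal_one]

lemma rmNorm_zero (p q : ℝ≥0∞) : rmNorm p q 0 = 0 := by
  have : (fun t : ℝ => radialNorm p 0 0 t) = 0 := by
    ext t
    exact eLpNorm_zero
  rw [rmNorm, this, eLpNorm_zero]

lemma rmNorm_add_le {p q : ℝ≥0∞} (hp : 1 ≤ p) (hq : 1 ≤ q) {f g : ℂ → ℂ}
    (hf : f ∈ holDisc) (hg : g ∈ holDisc) :
    rmNorm p q (f + g) ≤ rmNorm p q f + rmNorm p q g := by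
  refine le_trans (eLpNorm_mono_enorm (g := (fun t => radialNorm p f 0 t) +
    (fun t => radialNorm p g 0 t)) fun t => ?_)
    (eLpNorm_add_le (measurable_radialNorm hf p).aestronglyMeasurable
      (measurable_radialNorm hg p).aestronglyMeasurable hq)
  simp only [enorm_eq_self, Pi.add_apply]
  exact eLpNorm_add_le (measurable_ray hf t).aestronglyMeasurable
    (measurable_ray hg t).aestronglyMeasurable hp

lemma rmNorm_smul_le (p q : ℝ≥0∞) (c : ℂ) (f : ℂ → ℂ) :
    rmNorm p q (c • f) ≤ ‖c‖ₑ * rmNorm p q f := by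
  have h : ∀ t : ℝ, radialNorm p (c • f) 0 t = ‖c‖ₑ * radialNorm p f 0 t := fun t =>
    eLpNorm_const_smul c (fun r : ℝ => f (r * Complex.exp (t * Complex.I))) p _
  have := eLpNorm_le_nnreal_smul_eLpNorm_of_ae_le_mul' (μ := circleMeasure) (c := ‖c‖₊)
    (f := fun t : ℝ => radialNorm p (c • f) 0 t) (g := fun t : ℝ => radialNorm p f 0 t)
    (.of_forall fun t => by simp only [h, enorm_eq_self]; exact le_rfl) q
  exact this

lemma rmNorm_smul (p q : ℝ≥0∞) (c : ℂ) (f : ℂ → ℂ) :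
    rmNorm p q (c • f) = ‖c‖ₑ * rmNorm p q f := by
  obtain rfl | hc := eq_or_ne c 0
  · simp [rmNorm_zero]
  refine le_antisymm (rmNorm_smul_le p q c f) <| ENNReal.mul_le_of_le_div' ?_
  simpa [enorm_inv, hc, ENNReal.div_eq_inv_mul] using rmNorm_smul_le p q c⁻¹ (c • f)

lemma eq_zero_of_rmNorm {p q : ℝ≥0∞} (hp : 1 ≤ p) (hq : 1 ≤ q) {f : ℂ → ℂ}
    (hf : f ∈ holDisc) (h : rmNorm p q f = 0) : f = 0 := by
  have hp0 : p ≠ 0 := (lt_of_lt_of_le zero_lt_one hp).ne'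
  have hq0 : q ≠ 0 := (lt_of_lt_of_le zero_lt_one hq).ne'
  rw [rmNorm, eLpNorm_eq_zero_iff (measurable_radialNorm hf p).aestronglyMeasurable hq0] at h
  obtain ⟨t, ht⟩ := h.exists
  rw [Pi.zero_apply] at ht
  unfold radialNorm at ht
  rw [eLpNorm_eq_zero_iff (measurable_ray hf t).aestronglyMeasurable hp0] at ht
  have han : AnalyticOnNhd ℂ f (Metric.ball 0 1) := hf.1.analyticOnNhd Metric.isOpen_ball
  have hfreq : ∃ᶠ z in 𝓝[≠] (0 : ℂ), f z = 0 := by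
    have hE : ∃ᶠ r : ℝ in 𝓝[>] (0 : ℝ), f (r * Complex.exp (t * Complex.I)) = 0 := by
      intro hev
      obtain ⟨y, hy, hy'⟩ := (mem_nhdsGT_iff_exists_Ioo_subset' (zero_lt_one (α := ℝ))).1 hev
      have hy0 : (0 : ℝ) < y := hy
      have hae := (ae_restrict_iff' measurableSet_Ico).1 ht
      have h0 : volume (Ioo (0 : ℝ) (min y 1)) = 0 := by
        refine measure_mono_null (fun z hz => ?_) hae
        intro hz'
        exact hy' ⟨hz.1, hz.2.trans_le (min_le_left _ _)⟩
          (hz' ⟨hz.1.le, hz.2.trans_le (min_le_right _ _)⟩)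
      rw [Real.volume_Ioo, ENNReal.ofReal_eq_zero] at h0
      have : 0 < min y 1 := lt_min hy0 zero_lt_one
      linarith
    refine Tendsto.frequently (tendsto_nhdsWithin_iff.2 ⟨?_, ?_⟩) hE
    · have : Continuous fun r : ℝ => (r : ℂ) * Complex.exp (t * Complex.I) := by fun_prop
      simpa using (this.tendsto 0).mono_left nhdsWithin_le_nhds
    · filter_upwards [self_mem_nhdsWithin] with r hr
      have : (r : ℂ) ≠ 0 := by exact_mod_cast (ne_of_gt hr)
      simp [this, Complex.exp_ne_zero]
  have heq := han.eqOn_zero_of_preconnected_of_frequently_eq_zero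
    (convex_ball (0 : ℂ) 1).isPreconnected (Metric.mem_ball_self (one_pos (α := ℝ))) hfreq
  ext z
  by_cases hz : z ∈ Metric.ball (0 : ℂ) 1
  · exact heq hz
  · exact hf.2 z hz

/-! ### The Banach spaces -/

/-- The holomorphic functions on the disc with `ρ_{p,q}(f) < ∞`, for `1 ≤ p, q ≤ ∞`. -/
def rmSubmodule (p q : ℝ≥0∞) [Fact (1 ≤ p)] [Fact (1 ≤ q)] : Submodule ℂ (ℂ → ℂ) where
  carrier := {f | f ∈ holDisc ∧ rmNorm p q f < ∞}
  add_mem' hf hg := ⟨holDisc.add_mem hf.1 hg.1,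
    (rmNorm_add_le Fact.out Fact.out hf.1 hg.1).trans_lt (ENNReal.add_lt_top.2 ⟨hf.2, hg.2⟩)⟩
  zero_mem' := ⟨holDisc.zero_mem, by simp [rmNorm_zero]⟩
  smul_mem' c f hf := ⟨holDisc.smul_mem c hf.1, by
    rw [rmNorm_smul]; exact ENNReal.mul_lt_top (by simp) hf.2⟩

/-- The space `RM(p, q)`, normed by `ρ_{p,q}` (a type of its own, so that it does not carry the
topology of pointwise convergence). -/
def RM (p q : ℝ≥0∞) [Fact (1 ≤ p)] [Fact (1 ≤ q)] : Type := rmSubmodule p q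

section Instances

variable {p q : ℝ≥0∞} [Fact (1 ≤ p)] [Fact (1 ≤ q)]

instance : AddCommGroup (RM p q) := inferInstanceAs (AddCommGroup (rmSubmodule p q))

instance : Module ℂ (RM p q) := inferInstanceAs (Module ℂ (rmSubmodule p q))

/-- An element of `RM(p, q)` as a function. -/
instance : CoeFun (RM p q) (fun _ => ℂ → ℂ) := ⟨fun f => f.1⟩

lemma RM.coe_add (f g : RM p q) : (f + g : RM p q).1 = f.1 + g.1 := rfl

lemma RM.coe_smul (c : ℂ) (f : RM p q) : (c • f : RM p q).1 = c • f.1 := rfl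

lemma RM.coe_zero : (0 : RM p q).1 = 0 := rfl

instance : NormedAddCommGroup (RM p q) :=
  AddGroupNorm.toNormedAddCommGroup
    { toFun := fun f => (rmNorm p q f.1).toReal
      map_zero' := by simp [RM.coe_zero, rmNorm_zero]
      add_le' := fun f g => by
        rw [← ENNReal.toReal_add f.2.2.ne g.2.2.ne]
        exact ENNReal.toReal_mono (ENNReal.add_ne_top.2 ⟨f.2.2.ne, g.2.2.ne⟩)
          (rmNorm_add_le Fact.out Fact.out f.2.1 g.2.1)
      neg' := fun f => by
        rw [← neg_one_smul ℂ f, RM.coe_smul, rmNorm_smul]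
        simp
      eq_zero_of_map_eq_zero' := fun f hf => Subtype.ext <|
        eq_zero_of_rmNorm (p := p) (q := q) Fact.out Fact.out f.2.1
          (((ENNReal.toReal_eq_zero_iff _).1 hf).resolve_right f.2.2.ne) }

lemma RM.norm_def (f : RM p q) : ‖f‖ = (rmNorm p q f.1).toReal := rfl

instance : NormedSpace ℂ (RM p q) where
  norm_smul_le c f := by
    rw [RM.norm_def, RM.norm_def, RM.coe_smul, rmNorm_smul]
    simp

end Instances

/-- The Bergman space `A^p = RM(p, p)`. -/
abbrev Bergman (p : ℝ≥0∞) [Fact (1 ≤ p)] : Type := RM p p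

lemma radialNorm_add_le {p : ℝ≥0∞} (hp : 1 ≤ p) {f g : ℂ → ℂ} (hf : f ∈ holDisc)
    (hg : g ∈ holDisc) (s θ : ℝ) :
    radialNorm p (f + g) s θ ≤ radialNorm p f s θ + radialNorm p g s θ :=
  eLpNorm_add_le (measurable_ray hf θ).aestronglyMeasurable
    (measurable_ray hg θ).aestronglyMeasurable hp

/-- The subspace of `RM(p, ∞)` of those `f` with
`lim_{s → 1⁻} sup_θ (∫_s^1 |f(r e^{iθ})|^p dr)^{1/p} = 0`. -/
def rmZeroSubmodule (p : ℝ≥0∞) [Fact (1 ≤ p)] : Submodule ℂ (RM p ∞) where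
  carrier := {f | Tendsto (fun s : ℝ => ⨆ θ : ℝ, radialNorm p f s θ) (𝓝[<] 1) (𝓝 0)}
  add_mem' {f g} hf hg := by
    refine tendsto_of_tendsto_of_tendsto_of_le_of_le tendsto_const_nhds
      (by simpa using hf.add hg) (fun _ => bot_le) fun s => iSup_le fun θ => ?_
    exact (radialNorm_add_le Fact.out f.2.1 g.2.1 s θ).trans
      (add_le_add (le_iSup (fun θ => radialNorm p f s θ) θ)
        (le_iSup (fun θ => radialNorm p g s θ) θ))
  zero_mem' := by
    have : ∀ s θ : ℝ, radialNorm p (0 : RM p ∞).1 s θ = 0 := fun s θ => eLpNorm_zero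
    simp [this]
  smul_mem' c f hf := by
    have : ∀ s θ : ℝ, radialNorm p (c • f : RM p ∞).1 s θ = ‖c‖ₑ * radialNorm p f s θ :=
      fun s θ => eLpNorm_const_smul c (fun r : ℝ => f (r * Complex.exp (θ * Complex.I))) p _
    simp only [mem_ofPred_eq, this, ← ENNReal.mul_iSup]
    simpa using ENNReal.Tendsto.const_mul hf (Or.inr enorm_ne_top)

/-- The space `RM(p, 0)`, with the norm of `RM(p, ∞)`. -/
def RMZero (p : ℝ≥0∞) [Fact (1 ≤ p)] : Type := rmZeroSubmodule p

instance (p : ℝ≥0∞) [Fact (1 ≤ p)] : NormedAddCommGroup (RMZero p) :=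
  inferInstanceAs (NormedAddCommGroup (rmZeroSubmodule p))

instance (p : ℝ≥0∞) [Fact (1 ≤ p)] : NormedSpace ℂ (RMZero p) :=
  inferInstanceAs (NormedSpace ℂ (rmZeroSubmodule p))

lemma rmNorm_le_top {p : ℝ≥0∞} (q : ℝ≥0∞) {f : ℂ → ℂ} (hf : f ∈ holDisc) :
    rmNorm p q f ≤ rmNorm p ∞ f :=
  eLpNorm_le_eLpNorm_of_exponent_le le_top (measurable_radialNorm hf p).aestronglyMeasurable

/-- The inclusion `I : RM(p, 0) → A^p`. -/
def inclRMZero (p : ℝ≥0∞) [Fact (1 ≤ p)] : RMZero p →L[ℂ] Bergman p :=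
  LinearMap.mkContinuous
    { toFun := fun f => ⟨f.1.1, f.1.2.1, (rmNorm_le_top p f.1.2.1).trans_lt f.1.2.2⟩
      map_add' := fun _ _ => rfl
      map_smul' := fun _ _ => rfl } 1 fun f => by
        rw [one_mul]
        exact ENNReal.toReal_mono f.1.2.2.ne (rmNorm_le_top p f.1.2.1)

/-- The Banach space adjoint `T* : F* → E*`, `y* ↦ y* ∘ T`. -/
def banachAdjoint {E F : Type*} [NormedAddCommGroup E] [NormedSpace ℂ E] [NormedAddCommGroup F]
    [NormedSpace ℂ F] (T : E →L[ℂ] F) : StrongDual ℂ F →L[ℂ] StrongDual ℂ E :=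
  ContinuousLinearMap.precomp ℂ T

lemma banachAdjoint_apply {E F : Type*} [NormedAddCommGroup E] [NormedSpace ℂ E]
    [NormedAddCommGroup F] [NormedSpace ℂ F] (T : E →L[ℂ] F) (y : StrongDual ℂ F) (x : E) :
    banachAdjoint T y x = y (T x) := rfl

end

/-! The bidual is identified with `RM(p, ∞)` through Taylor coefficients. The coefficient
functionals `a_n` on `RM(p, 0)` satisfy `‖a_n‖ ≤ (1 - s)⁻¹ s⁻ⁿ` for every `s ∈ (0, 1)`, so `m` in
the bidual defines the holomorphic function `F = ∑ m(a_n) zⁿ` (`bidualFun`). The link between `m`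
and `F` is the dilation `D_r f(z) = f(rz)`, which sends any holomorphic function to a bounded one,
hence into `RM(p, 0)`, and has norm at most `r^(-1/p)`. Since `φ ∘ D_r = ∑ rⁿ φ(zⁿ) a_n` converges
in norm, `φ(D_r F) = m(φ ∘ D_r)` for every functional `φ` (`apply_ofDilate_bidualFun`). This bounds
`‖D_r F‖` by `r^(-1/p) ‖m‖`, and Fatou's lemma on rays gives `ρ_{p,∞}(F) ≤ ‖m‖`.

The decisive point, and the place where `p > 1` is needed, is that `φ ∘ D_r → φ` in norm as `r → 1`
(`RMZero.exists_norm_comp_dilateCLM_sub_le`). Otherwise there are functions of norm at most 3,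
arbitrarily small on any given disc, on which `Re φ ≥ ε`. Adding `N` of them that live essentially
on disjoint annuli gives norm `O(N^(1/p))`, because the radial integrals of `|f|^p` are additive,
whereas `Re φ ≥ Nε`; this is impossible for large `N`.

Hence `m(φ) = lim φ(D_r F)` along radii tending to 1, so `‖m‖ ≤ ρ_{p,∞}(F)`: the map `m ↦ F` is an
isometry. If `φ` comes from `A^p`, the same limit is `φ(F)`, since `D_r F → F` in `A^p`; thus `I**
m` is `F`. Every `f ∈ RM(p, ∞)` is reached by a weak-* cluster point of its dilations
(`exists_bidualFun_eq`), and weak-* null bounded sequences are treated by dominated convergence in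
the Taylor series. -/

/-! ### Taylor coefficients -/

/-- The `n`-th Taylor coefficient at the origin. -/
noncomputable def taylorCoeff (n : ℕ) (f : ℂ → ℂ) : ℂ := (n.factorial : ℂ)⁻¹ * iteratedDeriv n f 0

lemma contDiffAt_zero_of_mem_holDisc {f : ℂ → ℂ} (hf : f ∈ holDisc) (n : ℕ) :
    ContDiffAt ℂ n f 0 :=
  ((hf.1.analyticOnNhd Metric.isOpen_ball) 0 (Metric.mem_ball_self one_pos)).contDiffAt

lemma taylorCoeff_add (n : ℕ) {f g : ℂ → ℂ} (hf : f ∈ holDisc) (hg : g ∈ holDisc) :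
    taylorCoeff n (f + g) = taylorCoeff n f + taylorCoeff n g := by
  rw [taylorCoeff, iteratedDeriv_add (contDiffAt_zero_of_mem_holDisc hf n)
    (contDiffAt_zero_of_mem_holDisc hg n), mul_add]
  rfl

lemma taylorCoeff_smul (n : ℕ) (c : ℂ) (f : ℂ → ℂ) :
    taylorCoeff n (c • f) = c * taylorCoeff n f := by
  rw [taylorCoeff, taylorCoeff, iteratedDeriv_const_smul_field, smul_eq_mul]
  ring

lemma hasSum_taylorCoeff {f : ℂ → ℂ} (hf : f ∈ holDisc) {z : ℂ} (hz : z ∈ Metric.ball (0 : ℂ) 1) :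
    HasSum (fun n => taylorCoeff n f * z ^ n) (f z) := by
  have h := Complex.hasSum_taylorSeries_on_ball hf.1 hz
  simp only [sub_zero, smul_eq_mul] at h
  refine h.congr_fun fun n => ?_
  rw [taylorCoeff]
  ring

lemma norm_taylorCoeff_mul_pow_le {f : ℂ → ℂ} (hf : f ∈ holDisc) (n : ℕ) {r : ℝ} (hr : 0 < r)
    (hr1 : r < 1) :
    ‖taylorCoeff n f‖ * r ^ n ≤
      (2 * Real.pi)⁻¹ * ∫ θ : ℝ in 0..2 * Real.pi, ‖f (circleMap 0 r θ)‖ := by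
  lift r to ℝ≥0 using hr.le
  have h := (hf.1.mono (Metric.closedBall_subset_ball hr1)).hasFPowerSeriesOnBall
    (by exact_mod_cast hr)
  have h1 := h.factorial_smul (1 : ℂ) n
  rw [← iteratedDeriv_eq_iteratedFDeriv] at h1
  have h2 : taylorCoeff n f = cauchyPowerSeries f 0 r n fun _ => 1 := by
    rw [taylorCoeff, ← h1, nsmul_eq_mul, inv_mul_cancel_left₀]
    exact_mod_cast n.factorial_ne_zero
  have h3 : ‖taylorCoeff n f‖ ≤ ‖cauchyPowerSeries f 0 r n‖ := by
    rw [h2]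
    exact ((cauchyPowerSeries f 0 r n).le_opNorm fun _ => 1).trans_eq (by simp)
  have h4 := h3.trans (norm_cauchyPowerSeries_le f 0 r n)
  have hr' : (0 : ℝ) < r ^ n := by positivity
  rw [abs_of_pos hr, inv_pow] at h4
  calc _ ≤ _ := mul_le_mul_of_nonneg_right h4 hr'.le
    _ = _ := by rw [mul_assoc, inv_mul_cancel₀ hr'.ne', mul_one]

/-! ### Coefficient bounds in terms of `ρ_{p,q}`. -/

lemma lintegral_circleMeasure (g : ℝ → ℝ≥0∞) :
    ∫⁻ t, g t ∂circleMeasure =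
      ENNReal.ofReal (1 / (2 * Real.pi)) * ∫⁻ t in Ico 0 (2 * Real.pi), g t := by
  rw [circleMeasure, lintegral_smul_measure, smul_eq_mul]

lemma enorm_taylorCoeff_mul_pow_le {f : ℂ → ℂ} (hf : f ∈ holDisc) (n : ℕ) {r : ℝ} (hr : 0 < r)
    (hr1 : r < 1) :
    ‖taylorCoeff n f‖ₑ * ENNReal.ofReal (r ^ n) ≤
      ∫⁻ t : ℝ, ‖f (r * Complex.exp (t * Complex.I))‖ₑ ∂circleMeasure := by
  have hc : Continuous fun t : ℝ => f (r * Complex.exp (t * Complex.I)) :=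
    hf.1.continuousOn.comp_continuous (by fun_prop) fun t => polar_mem_ball ⟨hr.le, hr1⟩
  have h := norm_taylorCoeff_mul_pow_le hf n hr hr1
  have h2 : ∫ θ : ℝ in 0..2 * Real.pi, ‖f (circleMap 0 r θ)‖ =
      ∫ t in Ico 0 (2 * Real.pi), ‖f (r * Complex.exp (t * Complex.I))‖ := by
    rw [intervalIntegral.integral_of_le (by positivity), integral_Ico_eq_integral_Ioc]
    simp [circleMap]
  rw [h2] at h
  rw [lintegral_circleMeasure, ← ofReal_norm, ← ENNReal.ofReal_mul (norm_nonneg _)]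
  refine (ENNReal.ofReal_le_ofReal h).trans (le_of_eq ?_)
  rw [ENNReal.ofReal_mul (by positivity), one_div, ofReal_integral_eq_lintegral_ofReal]
  · simp [ofReal_norm]
  · exact (hc.norm.continuousOn.integrableOn_Icc).mono_set Ico_subset_Icc_self
  · exact .of_forall fun _ => norm_nonneg _

/-- Both `dr` on `[0, 1)` and `dt / 2π` are probability measures, so the norms increase with the
exponents. All coefficient bounds therefore reduce to `p = q = 1`. -/
lemma rmNorm_one_one_le {p q : ℝ≥0∞} (hp : 1 ≤ p) (hq : 1 ≤ q) {f : ℂ → ℂ} (hf : f ∈ holDisc) :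
    rmNorm 1 1 f ≤ rmNorm p q f := by
  have : IsProbabilityMeasure (volume.restrict (Ico (0 : ℝ) 1)) := ⟨by simp⟩
  refine le_trans (eLpNorm_mono_enorm fun t => ?_)
    (eLpNorm_le_eLpNorm_of_exponent_le hq (measurable_radialNorm hf p).aestronglyMeasurable)
  simp only [enorm_eq_self]
  exact eLpNorm_le_eLpNorm_of_exponent_le hp (measurable_ray hf t).aestronglyMeasurable

/-- Cauchy's estimate is integrated over the radii in `[s, 1)`, where `rⁿ ≥ sⁿ`, and Tonelli
exchanges radius and angle. The factor `1 - s` is the length of the interval. -/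
lemma enorm_taylorCoeff_le_rmNorm_one {f : ℂ → ℂ} (hf : f ∈ holDisc) (n : ℕ) {s : ℝ} (hs : 0 < s) :
    ‖taylorCoeff n f‖ₑ * ENNReal.ofReal (s ^ n) * ENNReal.ofReal (1 - s) ≤ rmNorm 1 1 f := by
  have hm := (measurable_of_mem_holDisc hf).comp measurable_polar
  calc ‖taylorCoeff n f‖ₑ * ENNReal.ofReal (s ^ n) * ENNReal.ofReal (1 - s)
      = ∫⁻ _ in Ico s 1, ‖taylorCoeff n f‖ₑ * ENNReal.ofReal (s ^ n) := by simp
    _ ≤ ∫⁻ r : ℝ in Ico s 1, ∫⁻ t : ℝ, ‖f (r * Complex.exp (t * Complex.I))‖ₑ ∂circleMeasure := by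
        refine setLIntegral_mono' measurableSet_Ico fun r hr => ?_
        refine le_trans ?_ (enorm_taylorCoeff_mul_pow_le hf n (hs.trans_le hr.1) hr.2)
        gcongr
        exact hr.1
    _ = ∫⁻ t : ℝ, (∫⁻ r : ℝ in Ico s 1, ‖f (r * Complex.exp (t * Complex.I))‖ₑ) ∂circleMeasure :=
        lintegral_lintegral_swap (hm.comp measurable_swap).enorm.aemeasurable
    _ ≤ ∫⁻ t : ℝ, (∫⁻ r : ℝ in Ico 0 1, ‖f (r * Complex.exp (t * Complex.I))‖ₑ) ∂circleMeasure :=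
        lintegral_mono fun t => lintegral_mono_set (Ico_subset_Ico_left hs.le)
    _ = rmNorm 1 1 f := by simp [rmNorm, radialNorm, eLpNorm_one_eq_lintegral_enorm]

/-- Cauchy's estimate for the Taylor coefficients in terms of `ρ_{p,q}`. -/
lemma RM.norm_taylorCoeff_le {p q : ℝ≥0∞} [Fact (1 ≤ p)] [Fact (1 ≤ q)] (f : RM p q) (n : ℕ)
    {s : ℝ} (hs : 0 < s) (hs1 : s < 1) :
    ‖taylorCoeff n f‖ ≤ (1 - s)⁻¹ * s⁻¹ ^ n * ‖f‖ := by
  have h := (enorm_taylorCoeff_le_rmNorm_one f.2.1 n hs).trans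
    (rmNorm_one_one_le (p := p) (q := q) Fact.out Fact.out f.2.1)
  have h2 := ENNReal.toReal_mono f.2.2.ne h
  have h1 : 0 < 1 - s := by linarith
  rw [← RM.norm_def, ENNReal.toReal_mul, ENNReal.toReal_mul, toReal_enorm,
    ENNReal.toReal_ofReal (by positivity), ENNReal.toReal_ofReal h1.le] at h2
  rw [inv_pow, ← mul_inv, inv_mul_eq_div, le_div_iff₀ (by positivity)]
  calc _ = _ := by ring
    _ ≤ _ := h2

/-! ### Bounded functions and dilations -/

lemma radialNorm_mono_left (p : ℝ≥0∞) (f : ℂ → ℂ) {s u : ℝ} (h : s ≤ u) (θ : ℝ) :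
    radialNorm p f u θ ≤ radialNorm p f s θ :=
  eLpNorm_mono_measure _ (Measure.restrict_mono (Ico_subset_Ico_left h) le_rfl)

/-- The factor `(1 - s)^(1/p)` tends to 0 for finite `p`, which is what places bounded functions in
`RM(p, 0)`. For `p = ∞` the exponent `p.toReal⁻¹` is 0 and the factor is 1. -/
lemma radialNorm_le_of_bound (p : ℝ≥0∞) {g : ℂ → ℂ} {M : ℝ}
    (hM : ∀ z ∈ Metric.ball (0 : ℂ) 1, ‖g z‖ ≤ M) {s : ℝ} (hs : 0 ≤ s) (θ : ℝ) :
    radialNorm p g s θ ≤ ENNReal.ofReal (1 - s) ^ p.toReal⁻¹ * ENNReal.ofReal M := by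
  have h := eLpNorm_le_of_ae_bound (p := p) (C := M) (μ := volume.restrict (Ico s 1))
    (f := fun r : ℝ => g (r * Complex.exp (θ * Complex.I)))
    ((ae_restrict_iff' measurableSet_Ico).2 (.of_forall fun r hr =>
      hM _ (polar_mem_ball ⟨hs.trans hr.1, hr.2⟩)))
  simpa [radialNorm] using h

lemma rmNorm_top_le {p : ℝ≥0∞} {f : ℂ → ℂ} {C : ℝ≥0∞}
    (h : ∀ᵐ t ∂circleMeasure, radialNorm p f 0 t ≤ C) : rmNorm p ∞ f ≤ C := by
  rw [rmNorm, eLpNorm_exponent_top]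
  exact essSup_le_of_ae_le _ h

lemma ae_radialNorm_le (p : ℝ≥0∞) (f : ℂ → ℂ) :
    ∀ᵐ t ∂circleMeasure, radialNorm p f 0 t ≤ rmNorm p ∞ f := by
  rw [rmNorm, eLpNorm_exponent_top]
  exact ae_le_eLpNormEssSup (f := fun t : ℝ => radialNorm p f 0 t)

lemma rmNorm_top_le_of_bound (p : ℝ≥0∞) {g : ℂ → ℂ} {M : ℝ}
    (hM : ∀ z ∈ Metric.ball (0 : ℂ) 1, ‖g z‖ ≤ M) : rmNorm p ∞ g ≤ ENNReal.ofReal M :=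
  rmNorm_top_le (.of_forall fun t => by simpa using radialNorm_le_of_bound p hM le_rfl t)

/-- A bounded holomorphic function as an element of `RM(p, 0)`. -/
def RMZero.ofBounded {p : ℝ≥0∞} [Fact (1 ≤ p)] (hp : p ≠ ∞) {g : ℂ → ℂ} (hg : g ∈ holDisc)
    (hM : ∃ M : ℝ, ∀ z ∈ Metric.ball (0 : ℂ) 1, ‖g z‖ ≤ M) : RMZero p :=
  ⟨⟨g, hg, (rmNorm_top_le_of_bound p hM.choose_spec).trans_lt ENNReal.ofReal_lt_top⟩, by
    obtain ⟨M, hM⟩ := hM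
    have hp0 : 0 < p.toReal⁻¹ := inv_pos.2 (ENNReal.toReal_pos
      (lt_of_lt_of_le zero_lt_one (Fact.out : 1 ≤ p)).ne' hp)
    have h : Tendsto (fun s : ℝ => ENNReal.ofReal (1 - s) ^ p.toReal⁻¹ * ENNReal.ofReal M)
        (𝓝[<] 1) (𝓝 0) := by
      have h1 : Tendsto (fun s : ℝ => ENNReal.ofReal (1 - s)) (𝓝[<] 1) (𝓝 0) := by
        have : Continuous fun s : ℝ => ENNReal.ofReal (1 - s) :=
          ENNReal.continuous_ofReal.comp (by fun_prop)
        simpa using (this.tendsto 1).mono_left nhdsWithin_le_nhds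
      have h2 := ENNReal.Tendsto.mul_const (b := ENNReal.ofReal M)
        ((ENNReal.continuous_rpow_const (y := p.toReal⁻¹)).tendsto 0 |>.comp h1)
        (Or.inr ENNReal.ofReal_ne_top)
      simpa [ENNReal.zero_rpow_of_pos hp0] using h2
    refine tendsto_of_tendsto_of_tendsto_of_le_of_le' tendsto_const_nhds h
      (.of_forall fun _ => bot_le) ?_
    filter_upwards [Ioo_mem_nhdsLT (zero_lt_one (α := ℝ))] with s hs
    exact iSup_le fun θ => radialNorm_le_of_bound p hM hs.1.le θ⟩

lemma RMZero.norm_def {p : ℝ≥0∞} [Fact (1 ≤ p)] (f : RMZero p) :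
    ‖f‖ = (rmNorm p ∞ f.1.1).toReal := rfl

lemma RMZero.norm_le_of_bound {p : ℝ≥0∞} [Fact (1 ≤ p)] (f : RMZero p) {M : ℝ} (hM0 : 0 ≤ M)
    (hM : ∀ z ∈ Metric.ball (0 : ℂ) 1, ‖f.1.1 z‖ ≤ M) : ‖f‖ ≤ M := by
  rw [RMZero.norm_def]
  exact ENNReal.toReal_le_of_le_ofReal hM0 (rmNorm_top_le_of_bound p hM)

/-- The dilation `z ↦ f (r z)`. -/
noncomputable def dilate (r : ℝ) (f : ℂ → ℂ) : ℂ → ℂ :=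
  (Metric.ball (0 : ℂ) 1).indicator fun z => f (r * z)

lemma dilate_apply (r : ℝ) (f : ℂ → ℂ) {z : ℂ} (hz : z ∈ Metric.ball (0 : ℂ) 1) :
    dilate r f z = f (r * z) := indicator_of_mem hz _

lemma dilate_add (r : ℝ) (f g : ℂ → ℂ) : dilate r (f + g) = dilate r f + dilate r g :=
  indicator_add _ _ _

lemma dilate_smul (r : ℝ) (c : ℂ) (f : ℂ → ℂ) : dilate r (c • f) = c • dilate r f :=
  indicator_const_smul _ c fun z => f (r * z)

lemma mul_mem_closedBall {r : ℝ} (hr : r ∈ Ioo (0 : ℝ) 1) {z : ℂ}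
    (hz : z ∈ Metric.ball (0 : ℂ) 1) : (r : ℂ) * z ∈ Metric.closedBall (0 : ℂ) r := by
  rw [mem_ball_zero_iff] at hz
  rw [mem_closedBall_zero_iff, norm_mul, Complex.norm_real, Real.norm_of_nonneg hr.1.le]
  exact mul_le_of_le_one_right hr.1.le hz.le

lemma mul_mem_unitBall {r : ℝ} (hr : r ∈ Ioo (0 : ℝ) 1) {z : ℂ}
    (hz : z ∈ Metric.ball (0 : ℂ) 1) : (r : ℂ) * z ∈ Metric.ball (0 : ℂ) 1 :=
  Metric.closedBall_subset_ball hr.2 (mul_mem_closedBall hr hz)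

lemma dilate_mem_holDisc {r : ℝ} (hr : r ∈ Ioo (0 : ℝ) 1) {f : ℂ → ℂ} (hf : f ∈ holDisc) :
    dilate r f ∈ holDisc :=
  ⟨(hf.1.comp (by fun_prop) fun _ hz => mul_mem_unitBall hr hz).congr
    fun _ hz => dilate_apply r f hz, fun _ hz => indicator_of_notMem hz _⟩

lemma exists_bound_dilate {r : ℝ} (hr : r ∈ Ioo (0 : ℝ) 1) {f : ℂ → ℂ} (hf : f ∈ holDisc) :
    ∃ M : ℝ, ∀ z ∈ Metric.ball (0 : ℂ) 1, ‖dilate r f z‖ ≤ M := by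
  obtain ⟨M, hM⟩ := (isCompact_closedBall (0 : ℂ) r).exists_bound_of_continuousOn
    (hf.1.continuousOn.mono (Metric.closedBall_subset_ball hr.2))
  exact ⟨M, fun z hz => by rw [dilate_apply r f hz]; exact hM _ (mul_mem_closedBall hr hz)⟩

/-- The substitution `u ↦ ru` carries `[s, 1)` to `[rs, r)` with Jacobian `r⁻¹`; the range is then
enlarged to `[rs, 1)`. -/
lemma radialNorm_dilate_le (p : ℝ≥0∞) {r : ℝ} (hr : r ∈ Ioo (0 : ℝ) 1) {f : ℂ → ℂ}
    (hf : f ∈ holDisc) {s : ℝ} (hs : 0 ≤ s) (θ : ℝ) :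
    radialNorm p (dilate r f) s θ ≤
      ENNReal.ofReal r⁻¹ ^ p.toReal⁻¹ * radialNorm p f (r * s) θ := by
  set F : ℝ → ℂ := fun u => f (u * Complex.exp (θ * Complex.I)) with hF
  have hFm : Measurable F := measurable_ray hf θ
  have h1 : radialNorm p (dilate r f) s θ =
      eLpNorm (F ∘ fun u => r * u) p (volume.restrict (Ico s 1)) := by
    refine eLpNorm_congr_ae ((ae_restrict_iff' measurableSet_Ico).2 (.of_forall fun u hu => ?_))
    simp only [dilate_apply r f (polar_mem_ball ⟨hs.trans hu.1, hu.2⟩), hF, Function.comp_apply]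
    push_cast
    rw [mul_assoc]
  have hpre : (fun u => r * u) ⁻¹' Ico (r * s) r = Ico s 1 := by
    ext u
    simp [mul_le_mul_iff_right₀ hr.1, mul_lt_iff_lt_one_right hr.1]
  have hmap : Measure.map (fun u => r * u) (volume.restrict (Ico s 1)) =
      ENNReal.ofReal r⁻¹ • volume.restrict (Ico (r * s) r) := by
    rw [← hpre, ← Measure.restrict_map (by fun_prop) measurableSet_Ico,
      Real.map_volume_mul_left hr.1.ne', Measure.restrict_smul, abs_of_pos (inv_pos.2 hr.1)]
  rw [h1, ← eLpNorm_map_measure hFm.aestronglyMeasurable (by fun_prop), hmap]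
  refine (eLpNorm_smul_measure_le _ F p _).trans ?_
  rw [one_div, ENNReal.toReal_inv, smul_eq_mul]
  gcongr
  exact eLpNorm_mono_measure F (Measure.restrict_mono (Ico_subset_Ico_right hr.2.le) le_rfl)

lemma rmNorm_dilate_le (p q : ℝ≥0∞) {r : ℝ} (hr : r ∈ Ioo (0 : ℝ) 1) {f : ℂ → ℂ}
    (hf : f ∈ holDisc) :
    rmNorm p q (dilate r f) ≤ ENNReal.ofReal r⁻¹ ^ p.toReal⁻¹ * rmNorm p q f := by
  have hC : ENNReal.ofReal r⁻¹ ^ p.toReal⁻¹ ≠ ∞ :=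
    ENNReal.rpow_ne_top_of_nonneg (by positivity) ENNReal.ofReal_ne_top
  lift ENNReal.ofReal r⁻¹ ^ p.toReal⁻¹ to ℝ≥0 using hC with C hCC
  have := eLpNorm_le_nnreal_smul_eLpNorm_of_ae_le_mul' (μ := circleMeasure) (c := C)
    (f := fun t : ℝ => radialNorm p (dilate r f) 0 t) (g := fun t : ℝ => radialNorm p f 0 t)
    (.of_forall fun t => by
      simpa [hCC] using radialNorm_dilate_le p hr hf le_rfl t) q
  exact this

section

variable {p : ℝ≥0∞} [Fact (1 ≤ p)]

/-- The dilation of a holomorphic function, as an element of `RM(p, 0)`. -/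
noncomputable def RMZero.ofDilate (hp : p ≠ ∞) {r : ℝ} (hr : r ∈ Ioo (0 : ℝ) 1) {f : ℂ → ℂ}
    (hf : f ∈ holDisc) : RMZero p :=
  RMZero.ofBounded hp (dilate_mem_holDisc hr hf) (exists_bound_dilate hr hf)

lemma RMZero.coe_ofDilate (hp : p ≠ ∞) {r : ℝ} (hr : r ∈ Ioo (0 : ℝ) 1) {f : ℂ → ℂ}
    (hf : f ∈ holDisc) : (RMZero.ofDilate hp hr hf).1.1 = dilate r f := rfl

lemma RMZero.norm_ofDilate_le (hp : p ≠ ∞) {r : ℝ} (hr : r ∈ Ioo (0 : ℝ) 1) (f : RM p ∞) :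
    ‖RMZero.ofDilate hp hr f.2.1‖ ≤ r⁻¹ ^ p.toReal⁻¹ * ‖f‖ := by
  have hC : ENNReal.ofReal r⁻¹ ^ p.toReal⁻¹ ≠ ∞ :=
    ENNReal.rpow_ne_top_of_nonneg (by positivity) ENNReal.ofReal_ne_top
  have h := ENNReal.toReal_mono (ENNReal.mul_ne_top hC f.2.2.ne) (rmNorm_dilate_le p ∞ hr f.2.1)
  rwa [ENNReal.toReal_mul, ← ENNReal.toReal_rpow, ENNReal.toReal_ofReal (inv_nonneg.2 hr.1.le),
    ← RM.norm_def] at h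

/-- The dilation operator on `RM(p, 0)`. -/
noncomputable def RMZero.dilateCLM (hp : p ≠ ∞) {r : ℝ} (hr : r ∈ Ioo (0 : ℝ) 1) :
    RMZero p →L[ℂ] RMZero p :=
  LinearMap.mkContinuous
    { toFun := fun f => RMZero.ofDilate hp hr f.1.2.1
      map_add' := fun f g => Subtype.ext (Subtype.ext (dilate_add r f.1.1 g.1.1))
      map_smul' := fun c f => Subtype.ext (Subtype.ext (dilate_smul r c f.1.1)) }
    (r⁻¹ ^ p.toReal⁻¹) fun f => RMZero.norm_ofDilate_le hp hr f.1

lemma RMZero.dilateCLM_apply (hp : p ≠ ∞) {r : ℝ} (hr : r ∈ Ioo (0 : ℝ) 1) (f : RMZero p) :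
    RMZero.dilateCLM hp hr f = RMZero.ofDilate hp hr f.1.2.1 := rfl

lemma RMZero.norm_dilateCLM_le (hp : p ≠ ∞) {r : ℝ} (hr : r ∈ Ioo (0 : ℝ) 1) :
    ‖RMZero.dilateCLM hp hr‖ ≤ r⁻¹ ^ p.toReal⁻¹ :=
  LinearMap.mkContinuous_norm_le _ (Real.rpow_nonneg (inv_nonneg.2 hr.1.le) _) _

/-- The Taylor coefficients as functionals on `RM(p, 0)`. -/
noncomputable def RMZero.coeff (p : ℝ≥0∞) [Fact (1 ≤ p)] (n : ℕ) : StrongDual ℂ (RMZero p) :=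
  LinearMap.mkContinuous
    { toFun := fun f => taylorCoeff n f.1.1
      map_add' := fun f g => taylorCoeff_add n f.1.2.1 g.1.2.1
      map_smul' := fun c f => taylorCoeff_smul n c f.1.1 }
    ((1 - 1 / 2)⁻¹ * (1 / 2 : ℝ)⁻¹ ^ n)
    fun f => RM.norm_taylorCoeff_le f.1 n (by norm_num) (by norm_num)

lemma RMZero.coeff_apply (n : ℕ) (f : RMZero p) : RMZero.coeff p n f = taylorCoeff n f.1.1 := rfl

lemma RMZero.norm_coeff_le (n : ℕ) {s : ℝ} (hs : 0 < s) (hs1 : s < 1) :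
    ‖RMZero.coeff p n‖ ≤ (1 - s)⁻¹ * s⁻¹ ^ n :=
  ContinuousLinearMap.opNorm_le_bound _
    (mul_nonneg (inv_nonneg.2 (by linarith)) (pow_nonneg (inv_nonneg.2 hs.le) _))
    fun f => RM.norm_taylorCoeff_le f.1 n hs hs1

lemma RMZero.summable_norm_coeff {r : ℝ} (hr : 0 ≤ r) (hr1 : r < 1) :
    Summable fun n => ‖RMZero.coeff p n‖ * r ^ n := by
  -- Cauchy's estimate at a radius `s > r` leaves a geometric series of ratio `r / s < 1`.
  obtain ⟨s, hs, hs1⟩ := exists_between hr1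
  have hs0 : 0 < s := hr.trans_lt hs
  refine Summable.of_nonneg_of_le (fun n => by positivity) (fun n => ?_)
    ((summable_geometric_of_lt_one (by positivity) ((div_lt_one hs0).2 hs)).mul_left (1 - s)⁻¹)
  calc ‖RMZero.coeff p n‖ * r ^ n ≤ (1 - s)⁻¹ * s⁻¹ ^ n * r ^ n := by
        gcongr
        exact RMZero.norm_coeff_le n hs0 hs1
    _ = (1 - s)⁻¹ * (r / s) ^ n := by rw [div_eq_inv_mul, mul_pow, mul_assoc]

/-- The monomial `z ^ n` as an element of `RM(p, 0)`. -/
noncomputable def RMZero.monomial (hp : p ≠ ∞) (n : ℕ) : RMZero p :=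
  RMZero.ofBounded hp (g := (Metric.ball (0 : ℂ) 1).indicator fun z => z ^ n)
    ⟨DifferentiableOn.congr (f := fun z : ℂ => z ^ n) (by fun_prop)
      fun _ hz => indicator_of_mem hz _, fun _ hz => indicator_of_notMem hz _⟩
    ⟨1, fun z hz => by
      rw [indicator_of_mem hz, norm_pow]
      exact pow_le_one₀ (norm_nonneg _) (mem_ball_zero_iff.1 hz).le⟩

lemma RMZero.monomial_apply (hp : p ≠ ∞) (n : ℕ) {z : ℂ} (hz : z ∈ Metric.ball (0 : ℂ) 1) :
    (RMZero.monomial hp n).1.1 z = z ^ n := indicator_of_mem hz _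

lemma RMZero.norm_monomial_le (hp : p ≠ ∞) (n : ℕ) : ‖RMZero.monomial hp n‖ ≤ 1 :=
  RMZero.norm_le_of_bound _ zero_le_one fun z hz => by
    rw [RMZero.monomial_apply hp n hz, norm_pow]
    exact pow_le_one₀ (norm_nonneg _) (mem_ball_zero_iff.1 hz).le

lemma RMZero.coe_finset_sum {ι : Type*} (S : Finset ι) (u : ι → RMZero p) (z : ℂ) :
    (∑ i ∈ S, u i).1.1 z = ∑ i ∈ S, (u i).1.1 z :=
  map_sum (⟨⟨fun f => f.1.1 z, rfl⟩, fun _ _ => rfl⟩ : RMZero p →+ ℂ) u S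

/-- The norm of `RM(p, 0)` is dominated by the supremum on the disc, and an absolutely summable
power series converges uniformly there. -/
lemma RMZero.hasSum_monomial (hp : p ≠ ∞) {b : ℕ → ℂ} (hb : Summable fun n => ‖b n‖)
    {g : RMZero p} (hg : ∀ z ∈ Metric.ball (0 : ℂ) 1, HasSum (fun n => b n * z ^ n) (g.1.1 z)) :
    HasSum (fun n => b n • RMZero.monomial hp n) g := by
  refine tendsto_iff_norm_sub_tendsto_zero.2 (squeeze_zero (fun _ => norm_nonneg _) (fun S => ?_)
    (tendsto_tsum_compl_atTop_zero fun n => ‖b n‖))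
  rw [norm_sub_rev]
  refine RMZero.norm_le_of_bound _ (tsum_nonneg fun _ => norm_nonneg _) fun z hz => ?_
  have hz1 : ‖z‖ ≤ 1 := (mem_ball_zero_iff.1 hz).le
  have h1 : (g - ∑ n ∈ S, b n • RMZero.monomial hp n).1.1 z = ∑' n : {n // n ∉ S}, b n * z ^ n.1 := by
    have h2 : (g - ∑ n ∈ S, b n • RMZero.monomial hp n).1.1 z =
        g.1.1 z - (∑ n ∈ S, b n • RMZero.monomial hp n).1.1 z := rfl
    have h3 : ∀ n, (b n • RMZero.monomial hp n).1.1 z = b n * z ^ n := fun n => by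
      rw [← RMZero.monomial_apply hp n hz]
      rfl
    rw [h2, RMZero.coe_finset_sum, sub_eq_iff_eq_add', ← (hg z hz).tsum_eq]
    simp only [h3]
    exact ((hg z hz).summable.sum_add_tsum_subtype_compl S).symm
  rw [h1]
  refine tsum_of_norm_bounded (hb.subtype _).hasSum fun n => ?_
  rw [norm_mul, norm_pow]
  exact mul_le_of_le_one_right (norm_nonneg _) (pow_le_one₀ (norm_nonneg _) hz1)

end

/-! ### Approximation of functionals by dilations -/

section

variable {p : ℝ≥0∞} [Fact (1 ≤ p)]

/-- Dilations converge to the identity uniformly on discs and on the unit ball of `RM(p, 0)`. -/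
lemma RMZero.exists_norm_dilate_sub_le {s δ : ℝ} (hs : 0 ≤ s) (hs1 : s < 1) (hδ : 0 < δ) :
    ∃ R < (1 : ℝ), ∀ r ∈ Ioo (0 : ℝ) 1, R < r → ∀ (f : RMZero p) (z : ℂ), ‖z‖ ≤ s →
      ‖dilate r f.1.1 z - f.1.1 z‖ ≤ δ * ‖f‖ := by
  have hsum := RMZero.summable_norm_coeff (p := p) hs hs1
  -- This series bounds `|f(rz) - f(z)| / ‖f‖` on `|z| ≤ s` without reference to `f`, which gives
  -- the uniformity on the unit ball.
  have hlim : Tendsto (fun r : ℝ => ∑' n, ‖RMZero.coeff p n‖ * s ^ n * (1 - r ^ n))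
      (𝓝[<] 1) (𝓝 0) := by
    have h := tendsto_tsum_of_dominated_convergence (𝓕 := 𝓝[<] (1 : ℝ))
      (f := fun r n => ‖RMZero.coeff p n‖ * s ^ n * (1 - r ^ n)) (g := fun _ => (0 : ℝ)) hsum
      (fun n => by
        have : Continuous fun r : ℝ => ‖RMZero.coeff p n‖ * s ^ n * (1 - r ^ n) := by fun_prop
        simpa using (this.tendsto 1).mono_left nhdsWithin_le_nhds)
      (by
        filter_upwards [Ioo_mem_nhdsLT (zero_lt_one (α := ℝ))] with r hr n
        have h1 := pow_le_one₀ (n := n) hr.1.le hr.2.le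
        have h2 := pow_nonneg hr.1.le n
        rw [Real.norm_of_nonneg (mul_nonneg (by positivity) (by linarith))]
        exact mul_le_of_le_one_right (by positivity) (by linarith))
    simpa using h
  obtain ⟨R, hR, hR'⟩ := (mem_nhdsLT_iff_exists_Ioo_subset' (zero_lt_one (α := ℝ))).1
    (hlim.eventually (gt_mem_nhds hδ))
  refine ⟨R, hR, fun r hr hRr f z hz => ?_⟩
  have hzb : z ∈ Metric.ball (0 : ℂ) 1 := mem_ball_zero_iff.2 (hz.trans_lt hs1)
  have h1 := (hasSum_taylorCoeff f.1.2.1 (mul_mem_unitBall hr hzb)).sub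
    (hasSum_taylorCoeff f.1.2.1 hzb)
  have hbd : ∀ n, ‖RMZero.coeff p n‖ * s ^ n * (1 - r ^ n) ≤ ‖RMZero.coeff p n‖ * s ^ n :=
    fun n => mul_le_of_le_one_right (by positivity) (by linarith [pow_nonneg hr.1.le n])
  have hnn : ∀ n, 0 ≤ 1 - r ^ n := fun n => by linarith [pow_le_one₀ (n := n) hr.1.le hr.2.le]
  have hsum' : Summable fun n => ‖RMZero.coeff p n‖ * s ^ n * (1 - r ^ n) :=
    Summable.of_nonneg_of_le (fun n => mul_nonneg (by positivity) (hnn n)) hbd hsum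
  rw [dilate_apply _ _ hzb, ← h1.tsum_eq]
  refine (tsum_of_norm_bounded (hsum'.mul_right ‖f‖).hasSum fun n => ?_).trans ?_
  · have h2 : taylorCoeff n f.1.1 * ((r : ℂ) * z) ^ n - taylorCoeff n f.1.1 * z ^ n =
        RMZero.coeff p n f * (z ^ n * (((r ^ n - 1 : ℝ)) : ℂ)) := by
      rw [RMZero.coeff_apply]
      push_cast
      ring
    rw [h2, norm_mul, norm_mul, norm_pow, Complex.norm_real, norm_sub_rev,
      Real.norm_of_nonneg (hnn n)]
    calc _ ≤ (‖RMZero.coeff p n‖ * ‖f‖) * (s ^ n * (1 - r ^ n)) := by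
          gcongr
          · exact mul_nonneg (by positivity) (hnn n)
          · exact (RMZero.coeff p n).le_opNorm f
          · exact hnn n
      _ = _ := by ring
  · rw [tsum_mul_right]
    have : ∑' n, ‖RMZero.coeff p n‖ * s ^ n * (1 - r ^ n) < δ := hR' ⟨hRr, hr.2⟩
    gcongr

/-! ### Additivity over annuli and the gliding hump. -/

lemma radialNorm_rpow_eq_add (hp : p ≠ ∞) (f : ℂ → ℂ) {s : ℝ} (hs : s ∈ Ioo (0 : ℝ) 1) (θ : ℝ) :
    radialNorm p f 0 θ ^ p.toReal =
      eLpNorm (fun r : ℝ => f (r * Complex.exp (θ * Complex.I))) p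
        (volume.restrict (Ico 0 s)) ^ p.toReal + radialNorm p f s θ ^ p.toReal := by
  have hp0 : p ≠ 0 := (lt_of_lt_of_le zero_lt_one (Fact.out : 1 ≤ p)).ne'
  have hP := ENNReal.toReal_pos hp0 hp
  have key : ∀ x : ℝ≥0∞, (x ^ (1 / p.toReal)) ^ p.toReal = x := fun x => by
    rw [← ENNReal.rpow_mul, one_div, inv_mul_cancel₀ hP.ne', ENNReal.rpow_one]
  simp only [radialNorm, eLpNorm_eq_lintegral_rpow_enorm_toReal hp0 hp, key]
  rw [← Ico_union_Ico_eq_Ico hs.1.le hs.2.le, lintegral_union measurableSet_Ico]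
  exact Set.disjoint_left.2 fun x hx hx' => absurd hx.2 (not_lt.2 hx'.1)

/-- The norm of a sum of two functions that live on complementary annuli, up to an error. -/
lemma RMZero.norm_add_rpow_le (hp : p ≠ ∞) (h g : RMZero p) {s δ : ℝ} (hs : s ∈ Ioo (0 : ℝ) 1)
    (hδ : 0 ≤ δ) (hh : ∀ θ, radialNorm p h.1.1 s θ ≤ ENNReal.ofReal δ)
    (hg : ∀ z : ℂ, ‖z‖ ≤ s → ‖g.1.1 z‖ ≤ δ) :
    ‖h + g‖ ^ p.toReal ≤ (‖h‖ + δ) ^ p.toReal + (‖g‖ + δ) ^ p.toReal := by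
  have hp1 : 1 ≤ p := Fact.out
  have hp0 : p ≠ 0 := (lt_of_lt_of_le zero_lt_one hp1).ne'
  have hP := ENNReal.toReal_pos hp0 hp
  have hof : ∀ k : RMZero p, rmNorm p ∞ k.1.1 = ENNReal.ofReal ‖k‖ := fun k => by
    rw [RMZero.norm_def, ENNReal.ofReal_toReal k.1.2.2.ne]
  have main : rmNorm p ∞ (h + g).1.1 ≤
      (ENNReal.ofReal (‖h‖ + δ) ^ p.toReal + ENNReal.ofReal (‖g‖ + δ) ^ p.toReal) ^
        (p.toReal)⁻¹ := by
    refine rmNorm_top_le ?_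
    filter_upwards [ae_radialNorm_le p h.1.1, ae_radialNorm_le p g.1.1] with t ht ht'
    rw [hof] at ht ht'
    rw [ENNReal.le_rpow_inv_iff hP, radialNorm_rpow_eq_add hp _ hs,
      ENNReal.ofReal_add (norm_nonneg _) hδ, ENNReal.ofReal_add (norm_nonneg _) hδ]
    -- On radii below `s`, `h` contributes at most `‖h‖` and `g` at most `δ`; on radii from `s` on,
    -- the roles are exchanged.
    refine add_le_add (ENNReal.rpow_le_rpow ?_ hP.le) (ENNReal.rpow_le_rpow ?_ hP.le)
    · refine (eLpNorm_add_le (measurable_ray h.1.2.1 t).aestronglyMeasurable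
        (measurable_ray g.1.2.1 t).aestronglyMeasurable hp1).trans (add_le_add ?_ ?_)
      · exact (eLpNorm_mono_measure _ (Measure.restrict_mono
          (Ico_subset_Ico_right hs.2.le) le_rfl)).trans ht
      · refine (eLpNorm_le_of_ae_bound (C := δ) ((ae_restrict_iff' measurableSet_Ico).2
          (.of_forall fun r hr => hg _ ?_))).trans ?_
        · simpa [Complex.norm_exp_ofReal_mul_I, abs_of_nonneg hr.1] using hr.2.le
        · refine mul_le_of_le_one_left zero_le (ENNReal.rpow_le_one ?_ (by positivity))
          simpa using hs.2.le
    · rw [add_comm (ENNReal.ofReal ‖g‖)]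
      exact (radialNorm_add_le hp1 h.1.2.1 g.1.2.1 s t).trans
        (add_le_add (hh t) ((radialNorm_mono_left p _ hs.1.le t).trans ht'))
  rw [ENNReal.le_rpow_inv_iff hP, hof, ENNReal.ofReal_rpow_of_nonneg (norm_nonneg _) hP.le,
    ENNReal.ofReal_rpow_of_nonneg (by positivity) hP.le,
    ENNReal.ofReal_rpow_of_nonneg (by positivity) hP.le,
    ← ENNReal.ofReal_add (by positivity) (by positivity),
    ENNReal.ofReal_le_ofReal_iff (by positivity)] at main
  exact main

lemma RMZero.exists_radialNorm_le (h : RMZero p) {δ : ℝ} (hδ : 0 < δ) :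
    ∃ s ∈ Ioo (0 : ℝ) 1, ∀ θ, radialNorm p h.1.1 s θ ≤ ENNReal.ofReal δ := by
  have h1 : Tendsto (fun s : ℝ => ⨆ θ : ℝ, radialNorm p h.1.1 s θ) (𝓝[<] 1) (𝓝 0) := h.2
  obtain ⟨s, hs, hs'⟩ := ((h1.eventually (gt_mem_nhds (ENNReal.ofReal_pos.2 hδ))).and
    (Ioo_mem_nhdsLT (zero_lt_one (α := ℝ)))).exists
  exact ⟨s, hs', fun θ => (le_iSup (fun θ => radialNorm p h.1.1 s θ) θ).trans hs.le⟩

/-- Gliding hump: a bounded family in `RM(p, 0)`, `p > 1`, that tends to `0` locally uniformly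
tends to `0` weakly. -/
lemma RMZero.not_forall_exists_le_re (hp1 : 1 < p) (hp : p ≠ ∞) (φ : StrongDual ℂ (RMZero p))
    {ε : ℝ} (hε : 0 < ε) (H : ∀ s ∈ Ioo (0 : ℝ) 1, ∀ δ > (0 : ℝ), ∃ g : RMZero p, ‖g‖ ≤ 3 ∧
      (∀ z : ℂ, ‖z‖ ≤ s → ‖g.1.1 z‖ ≤ δ) ∧ ε ≤ (φ g).re) : False := by
  have hp0 : p ≠ 0 := (zero_lt_one.trans hp1).ne'
  have hP := ENNReal.toReal_pos hp0 hp
  have hP1 : 1 < p.toReal := by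
    simpa using (ENNReal.toReal_lt_toReal ENNReal.one_ne_top hp).2 hp1
  -- The constant 4 is the bound 3 for each hump plus an error `δ < 1`. The extra 1, with strict
  -- inequality, leaves room to choose `δ` so small that replacing `‖h‖` by `‖h‖ + δ` keeps the
  -- bound.
  have step : ∀ N : ℕ, ∃ h : RMZero p, N * ε ≤ (φ h).re ∧
      ‖h‖ ^ p.toReal < N * 4 ^ p.toReal + 1 := by
    intro N
    induction N with
    | zero => exact ⟨0, by simp, by simp [Real.zero_rpow hP.ne']⟩
    | succ N ih =>
      obtain ⟨h, h1, h2⟩ := ih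
      have hcont : Continuous fun δ : ℝ => (‖h‖ + δ) ^ p.toReal :=
        (Real.continuous_rpow_const hP.le).comp (by fun_prop)
      have hev : ∀ᶠ δ in 𝓝[>] (0 : ℝ), (‖h‖ + δ) ^ p.toReal < N * 4 ^ p.toReal + 1 :=
        (hcont.tendsto 0).mono_left nhdsWithin_le_nhds |>.eventually
          (gt_mem_nhds (by simpa using h2))
      obtain ⟨δ, hδ, hδ'⟩ := (hev.and (Ioo_mem_nhdsGT (zero_lt_one (α := ℝ)))).exists
      obtain ⟨s, hs, hs'⟩ := h.exists_radialNorm_le hδ'.1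
      obtain ⟨g, hg, hg', hg''⟩ := H s hs δ hδ'.1
      refine ⟨h + g, ?_, ?_⟩
      · rw [map_add, Complex.add_re]
        push_cast
        linarith
      · have h3 := RMZero.norm_add_rpow_le hp h g hs hδ'.1.le hs' hg'
        have h4 : (‖g‖ + δ) ^ p.toReal ≤ 4 ^ p.toReal :=
          Real.rpow_le_rpow (by have := hδ'.1; positivity) (by linarith [hδ'.2]) hP.le
        push_cast
        linarith
  -- The contradiction is `N^p ε^p ≤ ‖φ‖^p N (4^p + 1)` for large `N`; it requires `p > 1`.
  have hlim : Tendsto (fun N : ℕ => (N : ℝ) ^ (p.toReal - 1)) atTop atTop :=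
    (tendsto_rpow_atTop (by linarith)).comp tendsto_natCast_atTop_atTop
  obtain ⟨N, hN, hN1⟩ := ((hlim.eventually_gt_atTop
    (‖φ‖ ^ p.toReal * (4 ^ p.toReal + 1) / ε ^ p.toReal)).and (eventually_ge_atTop 1)).exists
  obtain ⟨h, h1, h2⟩ := step N
  have hN0 : (1 : ℝ) ≤ N := by exact_mod_cast hN1
  have h3 : N * ε ≤ ‖φ‖ * ‖h‖ := h1.trans ((Complex.re_le_norm _).trans (φ.le_opNorm h))
  have h4 := Real.rpow_le_rpow (by positivity) h3 hP.le
  rw [Real.mul_rpow (by positivity) hε.le, Real.mul_rpow (by positivity) (by positivity)] at h4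
  have h5 : ‖φ‖ ^ p.toReal * ‖h‖ ^ p.toReal ≤ ‖φ‖ ^ p.toReal * (N * (4 ^ p.toReal + 1)) := by
    gcongr
    linarith
  rw [div_lt_iff₀ (by positivity)] at hN
  have h6 : (N : ℝ) ^ p.toReal = N * (N : ℝ) ^ (p.toReal - 1) := by
    rw [Real.rpow_sub_one (by positivity), mul_div_cancel₀ _ (by positivity)]
  have h7 := mul_lt_mul_of_pos_left hN (show (0 : ℝ) < N by linarith)
  rw [h6] at h4
  nlinarith

/-- Every functional `φ` on `RM(p, 0)`, `p > 1`, is the norm limit of its dilations. -/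
lemma RMZero.exists_norm_comp_dilateCLM_sub_le (hp1 : 1 < p) (hp : p ≠ ∞)
    (φ : StrongDual ℂ (RMZero p)) {ε : ℝ} (hε : 0 < ε) :
    ∃ R < (1 : ℝ), ∀ (r : ℝ) (hr : r ∈ Ioo (0 : ℝ) 1), R < r →
      ‖φ.comp (RMZero.dilateCLM hp hr) - φ‖ ≤ ε := by
  by_contra! hcon
  have hp0 : p ≠ 0 := (zero_lt_one.trans hp1).ne'
  have hP := ENNReal.toReal_pos hp0 hp
  have hP1 : 1 < p.toReal := by
    simpa using (ENNReal.toReal_lt_toReal ENNReal.one_ne_top hp).2 hp1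
  refine RMZero.not_forall_exists_le_re hp1 hp φ hε fun s hs δ hδ => ?_
  obtain ⟨R, hR, hR'⟩ := RMZero.exists_norm_dilate_sub_le (p := p) hs.1.le hs.2 hδ
  -- Radii above `1 / 2` have `‖D_r‖ ≤ 2`, so `D_r f - f` has norm at most 3 for `‖f‖ < 1`.
  obtain ⟨r, hr, hRr, hφ⟩ := hcon (max R (1 / 2)) (max_lt hR (by norm_num))
  obtain ⟨f, hf, hfφ⟩ := ContinuousLinearMap.exists_lt_apply_of_lt_opNorm _ hφ
  set w := (φ.comp (RMZero.dilateCLM hp hr) - φ) f with hw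
  have hw0 : w ≠ 0 := norm_pos_iff.1 (hε.trans hfφ)
  -- The unimodular factor that rotates the value `w` onto the positive real axis.
  set c : ℂ := (‖w‖ : ℂ) / w with hc
  have hc1 : ‖c‖ = 1 := by
    rw [hc, norm_div, Complex.norm_real, norm_norm, div_self (norm_ne_zero_iff.2 hw0)]
  have hr2 : r⁻¹ ^ p.toReal⁻¹ ≤ 2 := by
    have h1 : r⁻¹ ≤ 2 := by
      rw [inv_le_comm₀ hr.1 two_pos]
      linarith [(le_max_right R (1 / 2 : ℝ)).trans_lt hRr]
    calc r⁻¹ ^ p.toReal⁻¹ ≤ 2 ^ p.toReal⁻¹ :=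
          Real.rpow_le_rpow (inv_nonneg.2 hr.1.le) h1 (inv_nonneg.2 hP.le)
      _ ≤ 2 ^ (1 : ℝ) := Real.rpow_le_rpow_of_exponent_le one_le_two (inv_le_one_of_one_le₀ hP1.le)
      _ = 2 := Real.rpow_one 2
  refine ⟨c • (RMZero.dilateCLM hp hr f - f), ?_, fun z hz => ?_, ?_⟩
  · rw [norm_smul, hc1, one_mul]
    have h1 := (RMZero.dilateCLM hp hr).le_opNorm f
    have h2 := (RMZero.norm_dilateCLM_le hp hr).trans hr2
    have h3 : ‖RMZero.dilateCLM hp hr‖ * ‖f‖ ≤ 2 * 1 := by gcongr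
    linarith [norm_sub_le (RMZero.dilateCLM hp hr f) f]
  · have h1 : (c • (RMZero.dilateCLM hp hr f - f)).1.1 z =
        c * (dilate r f.1.1 z - f.1.1 z) := rfl
    rw [h1, norm_mul, hc1, one_mul]
    exact (hR' r hr ((le_max_left _ _).trans_lt hRr) f z hz).trans
      (mul_le_of_le_one_right hδ.le hf.le)
  · have h1 : φ (c • (RMZero.dilateCLM hp hr f - f)) = c * w := by
      rw [map_smul, map_sub, smul_eq_mul]
      rfl
    rw [h1, hc, div_mul_cancel₀ _ hw0, Complex.ofReal_re]
    exact hfφ.le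

end

/-! ### A sequence of dilations -/

/-- A sequence of radii that increases to `1`. -/
noncomputable def dilationRadius (n : ℕ) : ℝ := 1 - 1 / ((n + 1 : ℕ) + 1 : ℝ)

lemma tendsto_dilationRadius : Tendsto dilationRadius atTop (𝓝 1) := by
  have h := ((tendsto_add_atTop_iff_nat 1).2
    (tendsto_one_div_add_atTop_nhds_zero_nat (𝕜 := ℝ))).const_sub 1
  rw [sub_zero] at h
  exact h

lemma dilationRadius_mem (n : ℕ) : dilationRadius n ∈ Ioo (0 : ℝ) 1 := by
  have h1 : (0 : ℝ) < 1 / ((n + 1 : ℕ) + 1 : ℝ) := by positivity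
  have h2 : 1 / ((n + 1 : ℕ) + 1 : ℝ) < 1 := by
    rw [div_lt_one (by positivity)]
    push_cast
    linarith [(Nat.cast_nonneg n : (0 : ℝ) ≤ n)]
  exact ⟨by rw [dilationRadius]; linarith, by rw [dilationRadius]; linarith⟩

lemma tendsto_dilationRadius_inv_rpow (a : ℝ) :
    Tendsto (fun n => (dilationRadius n)⁻¹ ^ a) atTop (𝓝 1) := by
  have h := (tendsto_dilationRadius.inv₀ one_ne_zero).rpow_const (p := a) (Or.inl (by simp))
  simpa using h

lemma tendsto_dilate_apply {f : ℂ → ℂ} (hf : f ∈ holDisc) {z : ℂ}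
    (hz : z ∈ Metric.ball (0 : ℂ) 1) :
    Tendsto (fun n => dilate (dilationRadius n) f z) atTop (𝓝 (f z)) := by
  simp only [dilate_apply _ f hz]
  refine ((hf.1.continuousOn.continuousAt (Metric.isOpen_ball.mem_nhds hz)).tendsto).comp ?_
  have h := ((Complex.continuous_ofReal.tendsto 1).comp tendsto_dilationRadius).mul_const z
  simpa using h

lemma tendstoUniformlyOn_dilate {f : ℂ → ℂ} (hf : f ∈ holDisc) {s : ℝ} (hs1 : s < 1) :
    TendstoUniformlyOn (fun n => dilate (dilationRadius n) f) f atTop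
      (Metric.closedBall (0 : ℂ) s) := by
  have hsub : Metric.closedBall (0 : ℂ) s ⊆ Metric.ball 0 1 := Metric.closedBall_subset_ball hs1
  have huc := (isCompact_closedBall (0 : ℂ) s).uniformContinuousOn_of_continuous
    (hf.1.continuousOn.mono hsub)
  rw [Metric.tendstoUniformlyOn_iff]
  intro ε hε
  obtain ⟨δ, hδ, h⟩ := Metric.uniformContinuousOn_iff.1 huc ε hε
  filter_upwards [(Metric.tendsto_nhds.1 tendsto_dilationRadius) δ hδ] with n hn z hz
  have hr := dilationRadius_mem n
  rw [dilate_apply _ f (hsub hz)]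
  have hz' := mem_closedBall_zero_iff.1 hz
  have hz1 : ‖z‖ ≤ 1 := hz'.trans hs1.le
  refine h z hz _ ?_ ?_
  · rw [mem_closedBall_zero_iff, norm_mul, Complex.norm_real, Real.norm_of_nonneg hr.1.le]
    exact (mul_le_of_le_one_left (norm_nonneg _) hr.2.le).trans hz'
  · have h1 : z - dilationRadius n * z = ((1 - dilationRadius n : ℝ) : ℂ) * z := by
      push_cast
      ring
    rw [dist_eq_norm, h1, norm_mul, Complex.norm_real, ← dist_eq_norm, dist_comm]
    exact (mul_le_of_le_one_right dist_nonneg hz1).trans_lt hn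

section

variable {p : ℝ≥0∞} [Fact (1 ≤ p)]

lemma RMZero.tendsto_comp_dilateCLM (hp1 : 1 < p) (hp : p ≠ ∞) (φ : StrongDual ℂ (RMZero p)) :
    Tendsto (fun n => φ.comp (RMZero.dilateCLM hp (dilationRadius_mem n))) atTop (𝓝 φ) := by
  rw [Metric.tendsto_nhds]
  intro ε hε
  obtain ⟨R, hR, h⟩ := RMZero.exists_norm_comp_dilateCLM_sub_le hp1 hp φ (half_pos hε)
  filter_upwards [tendsto_dilationRadius.eventually (lt_mem_nhds hR)] with n hn
  rw [dist_eq_norm]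
  exact (h _ (dilationRadius_mem n) hn).trans_lt (half_lt_self hε)

/-! ### Convergence of the dilations on rays and in `A^p`. -/

lemma tendsto_radialNorm_nhdsLT_one (hp : p ≠ ∞) {f : ℂ → ℂ} {θ : ℝ}
    (hfin : radialNorm p f 0 θ < ∞) :
    Tendsto (fun s => radialNorm p f s θ) (𝓝[<] 1) (𝓝 0) := by
  have hp0 : p ≠ 0 := (lt_of_lt_of_le zero_lt_one (Fact.out : 1 ≤ p)).ne'
  have hP := ENNReal.toReal_pos hp0 hp
  have hint := (lintegral_rpow_enorm_lt_top_of_eLpNorm_lt_top hp0 hp hfin).ne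
  have hvol : Tendsto (fun s : ℝ => volume.restrict (Ico (0 : ℝ) 1) (Ico s 1)) (𝓝[<] 1) (𝓝 0) := by
    have h1 : Continuous fun s : ℝ => ENNReal.ofReal (1 - s) :=
      ENNReal.continuous_ofReal.comp (by fun_prop)
    have h2 : Tendsto (fun s : ℝ => ENNReal.ofReal (1 - s)) (𝓝[<] 1) (𝓝 0) := by
      simpa using (h1.tendsto 1).mono_left nhdsWithin_le_nhds
    refine tendsto_of_tendsto_of_tendsto_of_le_of_le tendsto_const_nhds h2
      (fun _ => bot_le) fun s => ?_
    exact (Measure.restrict_apply_le _ _).trans (by rw [Real.volume_Ico])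
  -- Absolute continuity of the integral of `|f|^p` along the ray.
  have h := tendsto_setLIntegral_zero hint hvol
  have h' := ((ENNReal.continuous_rpow_const (y := 1 / p.toReal)).tendsto 0).comp h
  rw [ENNReal.zero_rpow_of_pos (by positivity)] at h'
  refine h'.congr' ?_
  filter_upwards [Ioo_mem_nhdsLT (zero_lt_one (α := ℝ))] with s hs
  rw [Function.comp_apply, radialNorm, eLpNorm_eq_lintegral_rpow_enorm_toReal hp0 hp,
    Measure.restrict_restrict measurableSet_Ico,
    inter_eq_left.2 (Ico_subset_Ico_left hs.1.le)]

lemma radialNorm_sub_le {f g : ℂ → ℂ} (hf : f ∈ holDisc) (hg : g ∈ holDisc) (s θ : ℝ) :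
    radialNorm p (f - g) s θ ≤ radialNorm p f s θ + radialNorm p g s θ :=
  eLpNorm_sub_le (measurable_ray hf θ).aestronglyMeasurable
    (measurable_ray hg θ).aestronglyMeasurable Fact.out

lemma radialNorm_le_add (hp : p ≠ ∞) (f : ℂ → ℂ) {s : ℝ} (hs : s ∈ Ioo (0 : ℝ) 1) (θ : ℝ) :
    radialNorm p f 0 θ ≤
      eLpNorm (fun r : ℝ => f (r * Complex.exp (θ * Complex.I))) p
        (volume.restrict (Ico 0 s)) + radialNorm p f s θ := by
  have hp1 : 1 ≤ p := Fact.out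
  have hP := ENNReal.toReal_pos (zero_lt_one.trans_le hp1).ne' hp
  have hP1 : 1 ≤ p.toReal := by
    simpa using (ENNReal.toReal_le_toReal ENNReal.one_ne_top hp).2 hp1
  rw [← ENNReal.rpow_le_rpow_iff hP, radialNorm_rpow_eq_add hp f hs]
  exact ENNReal.add_rpow_le_rpow_add _ _ hP1

/-- The radii are `1 - 1 / (n + 2)`, hence at least `1 / 2`. A bound uniform in `n` is needed for
the dominated convergence of the dilations. -/
lemma dilationRadius_inv_rpow_le (hp : p ≠ ∞) (n : ℕ) :
    ENNReal.ofReal (dilationRadius n)⁻¹ ^ p.toReal⁻¹ ≤ 2 := by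
  have hp1 : 1 ≤ p := Fact.out
  have hP1 : 1 ≤ p.toReal := by
    simpa using (ENNReal.toReal_le_toReal ENNReal.one_ne_top hp).2 hp1
  have h1 : (dilationRadius n)⁻¹ ≤ 2 := by
    rw [inv_le_comm₀ (dilationRadius_mem n).1 two_pos, dilationRadius]
    have : 1 / ((n + 1 : ℕ) + 1 : ℝ) ≤ 1 / 2 := by
      apply one_div_le_one_div_of_le two_pos
      push_cast
      linarith [(Nat.cast_nonneg n : (0 : ℝ) ≤ n)]
    linarith
  calc ENNReal.ofReal (dilationRadius n)⁻¹ ^ p.toReal⁻¹ ≤ 2 ^ p.toReal⁻¹ := by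
        refine ENNReal.rpow_le_rpow ?_ (by positivity)
        simpa using ENNReal.ofReal_le_ofReal h1
    _ ≤ 2 ^ (1 : ℝ) := ENNReal.rpow_le_rpow_of_exponent_le one_le_two (inv_le_one_of_one_le₀ hP1)
    _ = 2 := ENNReal.rpow_one 2

lemma radialNorm_dilate_sub_le (hp : p ≠ ∞) {f : ℂ → ℂ} (hf : f ∈ holDisc) (n : ℕ) {s : ℝ}
    (hs : 0 ≤ s) (θ : ℝ) :
    radialNorm p (dilate (dilationRadius n) f - f) s θ ≤
      3 * radialNorm p f (dilationRadius n * s) θ := by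
  have hr := dilationRadius_mem n
  refine (radialNorm_sub_le (dilate_mem_holDisc hr hf) hf s θ).trans ?_
  rw [show (3 : ℝ≥0∞) = 2 + 1 by norm_num, add_mul, one_mul]
  refine add_le_add ((radialNorm_dilate_le p hr hf hs θ).trans ?_)
    (radialNorm_mono_left p f (mul_le_of_le_one_left hs hr.2.le) θ)
  gcongr
  exact dilationRadius_inv_rpow_le hp n

lemma tendsto_radialNorm_dilate_sub (hp : p ≠ ∞) {f : ℂ → ℂ} (hf : f ∈ holDisc) {θ : ℝ}
    (hfin : radialNorm p f 0 θ < ∞) :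
    Tendsto (fun n => radialNorm p (dilate (dilationRadius n) f - f) 0 θ) atTop (𝓝 0) := by
  rw [ENNReal.tendsto_nhds_zero]
  intro ε hε
  obtain ⟨δ, hδ, hδε⟩ := ENNReal.lt_iff_exists_nnreal_btwn.1 hε
  have hδ0 : 0 < δ := by exact_mod_cast hδ
  -- The tail of `D_r f - f` costs at most three tails of `f`, so `δ / 6` makes it `δ / 2`; uniform
  -- convergence on `|z| ≤ s` supplies the other `δ / 2`.
  obtain ⟨s₀, hs₀, hs₀'⟩ := (((tendsto_radialNorm_nhdsLT_one hp hfin).eventually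
    (gt_mem_nhds (show (0 : ℝ≥0∞) < (δ / 6 : ℝ≥0) by
      exact_mod_cast (by positivity : 0 < δ / 6)))).and
    (Ioo_mem_nhdsLT (zero_lt_one (α := ℝ)))).exists
  -- A cut strictly beyond `s₀` ensures that the dilated cut `r_n s` eventually exceeds `s₀`.
  obtain ⟨s, hs, hs1⟩ := exists_between hs₀'.2
  have hs' : s ∈ Ioo (0 : ℝ) 1 := ⟨hs₀'.1.trans hs, hs1⟩
  have hlim : Tendsto (fun n => dilationRadius n * s) atTop (𝓝 s) := by
    simpa using tendsto_dilationRadius.mul_const s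
  filter_upwards [hlim.eventually (lt_mem_nhds hs),
    Metric.tendstoUniformlyOn_iff.1 (tendstoUniformlyOn_dilate hf hs1) (δ / 2) (by positivity)]
    with n hn hun
  refine (radialNorm_le_add hp _ hs' θ).trans (le_trans ?_ hδε.le)
  have h1 : eLpNorm (fun r : ℝ => (dilate (dilationRadius n) f - f)
      (r * Complex.exp (θ * Complex.I))) p (volume.restrict (Ico 0 s)) ≤ (δ / 2 : ℝ≥0) := by
    refine (eLpNorm_le_of_ae_bound (C := δ / 2) ((ae_restrict_iff' measurableSet_Ico).2
      (.of_forall fun r hr => ?_))).trans ?_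
    · rw [Pi.sub_apply, ← dist_eq_norm, dist_comm]
      refine (hun _ ?_).le
      simpa [Complex.norm_exp_ofReal_mul_I, abs_of_nonneg hr.1] using hr.2.le
    · refine (mul_le_of_le_one_left zero_le (ENNReal.rpow_le_one ?_ (by positivity))).trans ?_
      · simpa using hs1.le
      · rw [show (δ / 2 : ℝ) = ((δ / 2 : ℝ≥0) : ℝ) by push_cast; rfl, ENNReal.ofReal_coe_nnreal]
  have h2 : radialNorm p (dilate (dilationRadius n) f - f) s θ ≤ (δ / 2 : ℝ≥0) := by
    refine (radialNorm_dilate_sub_le hp hf n hs'.1.le θ).trans ?_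
    have h3 : radialNorm p f (dilationRadius n * s) θ ≤ (δ / 6 : ℝ≥0) :=
      (radialNorm_mono_left p f hn.le θ).trans hs₀.le
    calc _ ≤ 3 * ((δ / 6 : ℝ≥0) : ℝ≥0∞) := by gcongr
      _ = (δ / 2 : ℝ≥0) := by
        have h4 : δ / 2 = 3 * (δ / 6) := by
          ext
          push_cast
          ring
        rw [h4, ENNReal.coe_mul]
        rfl
  calc _ ≤ ((δ / 2 : ℝ≥0) : ℝ≥0∞) + (δ / 2 : ℝ≥0) := add_le_add h1 h2
    _ = δ := by rw [← ENNReal.coe_add, add_halves]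

/-- The inclusion of `RM(p, ∞)` in the Bergman space. -/
noncomputable def RM.toBergman (f : RM p ∞) : Bergman p :=
  ⟨f.1, f.2.1, (rmNorm_le_top p f.2.1).trans_lt f.2.2⟩

lemma RM.norm_toBergman_le (f : RM p ∞) : ‖f.toBergman‖ ≤ ‖f‖ :=
  ENNReal.toReal_mono f.2.2.ne (rmNorm_le_top p f.2.1)

/-- On almost every ray `f` is `p`-integrable, so its dilations converge in `L^p` of the ray. The
ray norms of the differences are at most `3 ρ_{p,∞}(f)`, and dominated convergence in the angle
applies. -/
lemma RM.tendsto_inclRMZero_ofDilate (hp : p ≠ ∞) (f : RM p ∞) :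
    Tendsto (fun n => inclRMZero p (RMZero.ofDilate hp (dilationRadius_mem n) f.2.1)) atTop
      (𝓝 f.toBergman) := by
  have hp0 : p ≠ 0 := (lt_of_lt_of_le zero_lt_one (Fact.out : 1 ≤ p)).ne'
  have hP := ENNReal.toReal_pos hp0 hp
  have h1 : Tendsto (fun n => ∫⁻ t, radialNorm p (dilate (dilationRadius n) f.1 - f.1) 0 t ^ p.toReal
      ∂circleMeasure) atTop (𝓝 (∫⁻ _, 0 ∂circleMeasure)) := by
    refine tendsto_lintegral_of_dominated_convergence
      (fun _ => (3 * rmNorm p ∞ f.1) ^ p.toReal) (fun n => ?_) (fun n => ?_) ?_ ?_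
    · exact (measurable_radialNorm (holDisc.sub_mem (dilate_mem_holDisc (dilationRadius_mem n)
        f.2.1) f.2.1) p).pow_const _
    · filter_upwards [ae_radialNorm_le p f.1] with t ht
      refine ENNReal.rpow_le_rpow ?_ hP.le
      have h2 := radialNorm_dilate_sub_le hp f.2.1 n le_rfl t
      rw [mul_zero] at h2
      exact h2.trans (by gcongr)
    · rw [lintegral_const, measure_univ, mul_one]
      exact ENNReal.rpow_ne_top_of_nonneg hP.le (ENNReal.mul_ne_top (by norm_num) f.2.2.ne)
    · filter_upwards [ae_radialNorm_le p f.1] with t ht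
      have h2 := (ENNReal.continuous_rpow_const (y := p.toReal)).tendsto 0 |>.comp
        (tendsto_radialNorm_dilate_sub hp f.2.1 (ht.trans_lt f.2.2))
      rwa [ENNReal.zero_rpow_of_pos hP] at h2
  rw [lintegral_zero] at h1
  have h2 := (ENNReal.continuous_rpow_const (y := 1 / p.toReal)).tendsto 0 |>.comp h1
  rw [ENNReal.zero_rpow_of_pos (by positivity)] at h2
  have h3 : Tendsto (fun n => rmNorm p p (dilate (dilationRadius n) f.1 - f.1)) atTop (𝓝 0) := by
    refine h2.congr fun n => ?_
    rw [rmNorm, eLpNorm_eq_lintegral_rpow_enorm_toReal hp0 hp]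
    rfl
  rw [tendsto_iff_norm_sub_tendsto_zero]
  exact (ENNReal.tendsto_toReal ENNReal.zero_ne_top).comp h3

end

/-! ### The holomorphic function of an element of the bidual -/

section

variable {p : ℝ≥0∞} [Fact (1 ≤ p)]

/-- The function on the disc with Taylor coefficients `m (a_n)`, where `a_n` is the `n`-th Taylor
coefficient functional. -/
noncomputable def bidualFun (m : StrongDual ℂ (StrongDual ℂ (RMZero p))) : ℂ → ℂ :=
  (Metric.ball (0 : ℂ) 1).indicator fun z => ∑' n, m (RMZero.coeff p n) * z ^ n

lemma norm_bidual_coeff_mul_pow_le (m : StrongDual ℂ (StrongDual ℂ (RMZero p))) (n : ℕ) {s : ℝ}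
    {z : ℂ} (hz : ‖z‖ ≤ s) :
    ‖m (RMZero.coeff p n) * z ^ n‖ ≤ ‖m‖ * (‖RMZero.coeff p n‖ * s ^ n) := by
  rw [norm_mul, norm_pow, ← mul_assoc]
  gcongr
  exact m.le_opNorm _

lemma hasSum_bidualFun (m : StrongDual ℂ (StrongDual ℂ (RMZero p))) {z : ℂ}
    (hz : z ∈ Metric.ball (0 : ℂ) 1) :
    HasSum (fun n => m (RMZero.coeff p n) * z ^ n) (bidualFun m z) := by
  rw [bidualFun, indicator_of_mem hz]
  exact (Summable.of_norm_bounded ((RMZero.summable_norm_coeff (norm_nonneg z)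
    (mem_ball_zero_iff.1 hz)).mul_left ‖m‖)
    fun n => norm_bidual_coeff_mul_pow_le m n le_rfl).hasSum

lemma bidualFun_mem_holDisc (m : StrongDual ℂ (StrongDual ℂ (RMZero p))) :
    bidualFun m ∈ holDisc := by
  refine ⟨fun z hz => ?_, fun z hz => indicator_of_notMem hz _⟩
  obtain ⟨s, hs, hs1⟩ := exists_between (mem_ball_zero_iff.1 hz)
  have hd : DifferentiableOn ℂ (fun z => ∑' n, m (RMZero.coeff p n) * z ^ n)
      (Metric.ball (0 : ℂ) s) :=
    Complex.differentiableOn_tsum_of_summable_norm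
      ((RMZero.summable_norm_coeff ((norm_nonneg z).trans hs.le) hs1).mul_left ‖m‖)
      (fun n => by fun_prop) Metric.isOpen_ball
      fun n w hw => norm_bidual_coeff_mul_pow_le m n (mem_ball_zero_iff.1 hw).le
  have hd' : DifferentiableOn ℂ (bidualFun m) (Metric.ball (0 : ℂ) s) := hd.congr fun w hw =>
    indicator_of_mem (Metric.ball_subset_ball hs1.le hw) _
  exact (hd'.differentiableAt (Metric.isOpen_ball.mem_nhds
    (mem_ball_zero_iff.2 hs))).differentiableWithinAt

lemma bidualFun_add (m m' : StrongDual ℂ (StrongDual ℂ (RMZero p))) :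
    bidualFun (m + m') = bidualFun m + bidualFun m' := by
  ext z
  by_cases hz : z ∈ Metric.ball (0 : ℂ) 1
  · refine (hasSum_bidualFun (m + m') hz).unique
      (((hasSum_bidualFun m hz).add (hasSum_bidualFun m' hz)).congr_fun fun n => ?_)
    rw [_root_.add_apply, add_mul]
  · simp [bidualFun, indicator_of_notMem hz]

lemma bidualFun_smul (c : ℂ) (m : StrongDual ℂ (StrongDual ℂ (RMZero p))) :
    bidualFun (c • m) = c • bidualFun m := by
  ext z
  by_cases hz : z ∈ Metric.ball (0 : ℂ) 1
  · refine (hasSum_bidualFun (c • m) hz).unique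
      (((hasSum_bidualFun m hz).mul_left c).congr_fun fun n => ?_)
    rw [_root_.smul_apply, smul_eq_mul, mul_assoc]
  · simp [bidualFun, indicator_of_notMem hz]

/-- `m` acts on dilated functionals as the dilations of its function. -/
lemma apply_ofDilate_bidualFun (hp : p ≠ ∞) {r : ℝ} (hr : r ∈ Ioo (0 : ℝ) 1)
    (m : StrongDual ℂ (StrongDual ℂ (RMZero p))) (φ : StrongDual ℂ (RMZero p)) :
    φ (RMZero.ofDilate hp hr (bidualFun_mem_holDisc m)) =
      m (φ.comp (RMZero.dilateCLM hp hr)) := by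
  have hs := RMZero.summable_norm_coeff (p := p) hr.1.le hr.2
  have hrn : ∀ n, ‖(r : ℂ) ^ n‖ = r ^ n := fun n => by
    rw [norm_pow, Complex.norm_real, Real.norm_of_nonneg hr.1.le]
  have h1 : HasSum (fun n => (m (RMZero.coeff p n) * (r : ℂ) ^ n) • RMZero.monomial hp n)
      (RMZero.ofDilate hp hr (bidualFun_mem_holDisc m)) := by
    refine RMZero.hasSum_monomial hp (Summable.of_nonneg_of_le (fun _ => norm_nonneg _)
      (fun n => norm_bidual_coeff_mul_pow_le m n (s := r) ?_) (hs.mul_left ‖m‖)) fun z hz => ?_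
    · rw [Complex.norm_real, Real.norm_of_nonneg hr.1.le]
    · rw [RMZero.coe_ofDilate, dilate_apply _ _ hz]
      refine (hasSum_bidualFun m (mul_mem_unitBall hr hz)).congr_fun fun n => ?_
      rw [mul_pow, mul_assoc]
  have h2 : ∀ g : RMZero p, HasSum (fun n => (RMZero.coeff p n g * (r : ℂ) ^ n) •
      RMZero.monomial hp n) (RMZero.dilateCLM hp hr g) := by
    intro g
    refine RMZero.hasSum_monomial hp (Summable.of_nonneg_of_le (fun _ => norm_nonneg _)
      (fun n => ?_) (hs.mul_right ‖g‖)) fun z hz => ?_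
    · rw [norm_mul, hrn, mul_right_comm]
      exact mul_le_mul_of_nonneg_right ((RMZero.coeff p n).le_opNorm g) (pow_nonneg hr.1.le n)
    · rw [RMZero.dilateCLM_apply, RMZero.coe_ofDilate, dilate_apply _ _ hz]
      refine (hasSum_taylorCoeff g.1.2.1 (mul_mem_unitBall hr hz)).congr_fun fun n => ?_
      rw [mul_pow, mul_assoc, RMZero.coeff_apply]
  have h3 : Summable fun n => ((r : ℂ) ^ n * φ (RMZero.monomial hp n)) • RMZero.coeff p n := by
    refine Summable.of_norm_bounded (hs.mul_right ‖φ‖) fun n => ?_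
    rw [norm_smul, norm_mul, hrn, mul_comm, ← mul_assoc]
    exact mul_le_mul_of_nonneg_left (φ.unit_le_opNorm _ (RMZero.norm_monomial_le hp n))
      (mul_nonneg (norm_nonneg _) (pow_nonneg hr.1.le n))
  -- Norm convergence in the dual is essential here: it permits applying `m` term by term.
  have h4 : HasSum (fun n => ((r : ℂ) ^ n * φ (RMZero.monomial hp n)) • RMZero.coeff p n)
      (φ.comp (RMZero.dilateCLM hp hr)) := by
    convert h3.hasSum
    ext g
    refine (φ.hasSum (h2 g)).unique ?_
    refine ((NormedSpace.inclusionInDoubleDual ℂ (RMZero p) g).hasSum h3.hasSum).congr_fun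
      fun n => ?_
    simp only [map_smul, NormedSpace.dual_def, smul_eq_mul]
    ring
  refine (φ.hasSum h1).unique ((m.hasSum h4).congr_fun fun n => ?_)
  simp only [map_smul, smul_eq_mul]
  ring

/-- By Hahn–Banach it is enough to test against functionals `φ`, where the value is `m(φ ∘ D_r)`. -/
lemma norm_ofDilate_bidualFun_le (hp : p ≠ ∞) {r : ℝ} (hr : r ∈ Ioo (0 : ℝ) 1)
    (m : StrongDual ℂ (StrongDual ℂ (RMZero p))) :
    ‖RMZero.ofDilate hp hr (bidualFun_mem_holDisc m)‖ ≤ r⁻¹ ^ p.toReal⁻¹ * ‖m‖ := by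
  have h0 : 0 ≤ r⁻¹ ^ p.toReal⁻¹ := Real.rpow_nonneg (inv_nonneg.2 hr.1.le) _
  refine NormedSpace.norm_le_dual_bound ℂ _ (mul_nonneg h0 (norm_nonneg m)) fun φ => ?_
  rw [apply_ofDilate_bidualFun]
  calc _ ≤ ‖m‖ * (‖φ‖ * r⁻¹ ^ p.toReal⁻¹) := (m.le_opNorm _).trans (by
        gcongr
        exact (φ.opNorm_comp_le _).trans (by
          gcongr
          exact RMZero.norm_dilateCLM_le hp hr))
    _ = _ := by ring

/-- Fatou's lemma on almost every ray, applied to the dilations, whose norm bounds `r_n^(-1/p) ‖m‖`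
tend to `‖m‖`. Using a sequence of radii keeps the union of the exceptional sets of angles null. -/
lemma rmNorm_bidualFun_le (hp : p ≠ ∞) (m : StrongDual ℂ (StrongDual ℂ (RMZero p))) :
    rmNorm p ∞ (bidualFun m) ≤ ENNReal.ofReal ‖m‖ := by
  refine rmNorm_top_le ?_
  have h1 : ∀ᵐ t ∂circleMeasure, ∀ n, radialNorm p (dilate (dilationRadius n) (bidualFun m)) 0 t ≤
      ENNReal.ofReal ((dilationRadius n)⁻¹ ^ p.toReal⁻¹ * ‖m‖) := by
    rw [ae_all_iff]
    intro n
    have h2 := norm_ofDilate_bidualFun_le hp (dilationRadius_mem n) m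
    filter_upwards [ae_radialNorm_le p (dilate (dilationRadius n) (bidualFun m))] with t ht
    refine ht.trans ?_
    exact (ENNReal.le_ofReal_iff_toReal_le
      (RMZero.ofDilate hp (dilationRadius_mem n) (bidualFun_mem_holDisc m)).1.2.2.ne
      ((norm_nonneg _).trans h2)).2 h2
  filter_upwards [h1] with t ht
  have h3 : radialNorm p (bidualFun m) 0 t ≤ atTop.liminf fun n =>
      radialNorm p (dilate (dilationRadius n) (bidualFun m)) 0 t := by
    refine Lp.eLpNorm_lim_le_liminf_eLpNorm (fun n => (measurable_ray (dilate_mem_holDisc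
      (dilationRadius_mem n) (bidualFun_mem_holDisc m)) t).aestronglyMeasurable) _
      ((ae_restrict_iff' measurableSet_Ico).2 (.of_forall fun r hr => ?_))
    exact tendsto_dilate_apply (bidualFun_mem_holDisc m) (polar_mem_ball hr)
  have h4 : Tendsto (fun n => ENNReal.ofReal ((dilationRadius n)⁻¹ ^ p.toReal⁻¹ * ‖m‖)) atTop
      (𝓝 (ENNReal.ofReal ‖m‖)) := by
    have h := (tendsto_dilationRadius_inv_rpow p.toReal⁻¹).mul_const ‖m‖
    rw [one_mul] at h
    exact ENNReal.tendsto_ofReal h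
  refine h3.trans ((liminf_le_liminf (.of_forall ht)).trans_eq h4.liminf_eq)

/-- The element of `RM(p, ∞)` that corresponds to an element of the bidual of `RM(p, 0)`. -/
noncomputable def bidualToRM (hp : p ≠ ∞) (m : StrongDual ℂ (StrongDual ℂ (RMZero p))) : RM p ∞ :=
  ⟨bidualFun m, bidualFun_mem_holDisc m,
    (rmNorm_bidualFun_le hp m).trans_lt ENNReal.ofReal_lt_top⟩

lemma norm_bidualToRM_le (hp : p ≠ ∞) (m : StrongDual ℂ (StrongDual ℂ (RMZero p))) :
    ‖bidualToRM hp m‖ ≤ ‖m‖ :=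
  ENNReal.toReal_le_of_le_ofReal (norm_nonneg m) (rmNorm_bidualFun_le hp m)

/-- The values are `m(φ ∘ D_{r_n})`, and `φ ∘ D_{r_n} → φ` in norm. So `m` is determined by its
function. -/
lemma tendsto_apply_ofDilate_bidualFun (hp1 : 1 < p) (hp : p ≠ ∞)
    (m : StrongDual ℂ (StrongDual ℂ (RMZero p))) (φ : StrongDual ℂ (RMZero p)) :
    Tendsto (fun n => φ (RMZero.ofDilate hp (dilationRadius_mem n) (bidualFun_mem_holDisc m)))
      atTop (𝓝 (m φ)) := by
  simp only [apply_ofDilate_bidualFun]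
  exact (m.continuous.tendsto φ).comp (RMZero.tendsto_comp_dilateCLM hp1 hp φ)

lemma norm_bidualToRM (hp1 : 1 < p) (hp : p ≠ ∞) (m : StrongDual ℂ (StrongDual ℂ (RMZero p))) :
    ‖bidualToRM hp m‖ = ‖m‖ := by
  refine le_antisymm (norm_bidualToRM_le hp m) (m.opNorm_le_bound (norm_nonneg _) fun φ => ?_)
  have h1 := ((tendsto_dilationRadius_inv_rpow p.toReal⁻¹).mul_const
    ‖bidualToRM hp m‖).const_mul ‖φ‖
  rw [one_mul, mul_comm] at h1
  refine le_of_tendsto_of_tendsto' (tendsto_apply_ofDilate_bidualFun hp1 hp m φ).norm h1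
    fun n => (φ.le_opNorm _).trans ?_
  gcongr
  exact RMZero.norm_ofDilate_le hp (dilationRadius_mem n) (bidualToRM hp m)

/-- Both sides are limits of `φ` on the same dilations: one by convergence in `A^p`, the other by
the recovery of `m` from its dilations. -/
lemma apply_toBergman_bidualToRM (hp1 : 1 < p) (hp : p ≠ ∞)
    (m : StrongDual ℂ (StrongDual ℂ (RMZero p))) (φ : StrongDual ℂ (Bergman p)) :
    φ (bidualToRM hp m).toBergman = m (φ.comp (inclRMZero p)) :=
  tendsto_nhds_unique
    ((φ.continuous.tendsto _).comp (RM.tendsto_inclRMZero_ofDilate hp (bidualToRM hp m)))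
    (tendsto_apply_ofDilate_bidualFun hp1 hp m (φ.comp (inclRMZero p)))

/-- Every function in `RM(p, ∞)` comes from the bidual of `RM(p, 0)`: a weak-`*` cluster point of
its dilations. -/
lemma exists_bidualFun_eq (hp : p ≠ ∞) (f : RM p ∞) :
    ∃ m : StrongDual ℂ (StrongDual ℂ (RMZero p)), bidualFun m = f.1 := by
  set u : ℕ → RMZero p := fun n => RMZero.ofDilate hp (dilationRadius_mem n) f.2.1 with hu
  have hbdd : ∃ C, ∀ n, ‖u n‖ ≤ C := by
    obtain ⟨C, hC⟩ := ((tendsto_dilationRadius_inv_rpow p.toReal⁻¹).mul_const ‖f‖).bddAbove_range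
    exact ⟨C, fun n => (RMZero.norm_ofDilate_le hp (dilationRadius_mem n) f).trans
      (hC (mem_range_self n))⟩
  obtain ⟨C, hC⟩ := hbdd
  -- Banach–Alaoglu; the limit is taken along a nonprincipal ultrafilter, so no sequential
  -- compactness is needed.
  obtain ⟨m, -, hm⟩ := (WeakDual.isCompact_closedBall (𝕜 := ℂ) (E := StrongDual ℂ (RMZero p))
    0 C).ultrafilter_le_nhds' ((hyperfilter ℕ).map fun n =>
      StrongDual.toWeakDual (NormedSpace.inclusionInDoubleDual ℂ (RMZero p) (u n)))
    (by
      refine Ultrafilter.mem_map.2 (univ_mem' fun n => ?_)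
      have h1 : NormedSpace.inclusionInDoubleDual ℂ (RMZero p) (u n) ∈ Metric.closedBall 0 C :=
        Metric.mem_closedBall.2 ((dist_zero_right
          (NormedSpace.inclusionInDoubleDual ℂ (RMZero p) (u n))).trans_le
          ((NormedSpace.double_dual_bound ℂ _ _).trans (hC n)))
      exact h1)
  refine ⟨WeakDual.toStrongDual m, ?_⟩
  have hlim : ∀ φ : StrongDual ℂ (RMZero p),
      Tendsto (fun n => φ (u n)) (hyperfilter ℕ) (𝓝 (m φ)) := fun φ =>
    ((WeakDual.eval_continuous φ).tendsto m).comp hm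
  ext z
  by_cases hz : z ∈ Metric.ball (0 : ℂ) 1
  swap
  · rw [f.2.1.2 z hz]
    exact indicator_of_notMem hz _
  -- Evaluation at `z` is this norm-convergent series in the dual, so the weak-* limit can be tested
  -- on it.
  have hsum : Summable fun n => (z ^ n) • RMZero.coeff p n :=
    Summable.of_norm_bounded (RMZero.summable_norm_coeff (norm_nonneg z) (mem_ball_zero_iff.1 hz))
      fun n => by rw [norm_smul, norm_pow, mul_comm]
  have heval : ∀ g : RMZero p, (∑' n, (z ^ n) • RMZero.coeff p n) g = g.1.1 z := fun g => by
    refine HasSum.unique ((NormedSpace.inclusionInDoubleDual ℂ (RMZero p) g).hasSum hsum.hasSum)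
      ((hasSum_taylorCoeff g.1.2.1 hz).congr_fun fun n => ?_)
    simp only [map_smul, NormedSpace.dual_def, smul_eq_mul,
      RMZero.coeff_apply]
    ring
  have h1 : bidualFun (WeakDual.toStrongDual m) z = m (∑' n, (z ^ n) • RMZero.coeff p n) := by
    refine (hasSum_bidualFun _ hz).unique
      (((WeakDual.toStrongDual m).hasSum hsum.hasSum).congr_fun fun n => ?_)
    simp only [map_smul, smul_eq_mul]
    ring
  rw [h1]
  refine tendsto_nhds_unique (hlim _) ?_
  simp only [heval]
  exact (tendsto_dilate_apply f.2.1 hz).mono_left Nat.hyperfilter_le_atTop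

/-- Weak-* convergence sends each Taylor coefficient to 0, and boundedness gives the summable
majorant `C ‖a_k‖ s^k`. -/
lemma tendstoUniformlyOn_bidualFun {x : ℕ → StrongDual ℂ (StrongDual ℂ (RMZero p))}
    (hx : Bornology.IsBounded (range x))
    (hx0 : Tendsto (fun n => StrongDual.toWeakDual (x n)) atTop (𝓝 0)) {s : ℝ} (hs : 0 ≤ s)
    (hs1 : s < 1) :
    TendstoUniformlyOn (fun n => bidualFun (x n)) 0 atTop (Metric.ball 0 s) := by
  obtain ⟨C, hC⟩ := hx.exists_norm_le
  have hC' : ∀ n, ‖x n‖ ≤ C := fun n => hC _ (mem_range_self n)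
  have hsum := (RMZero.summable_norm_coeff (p := p) hs hs1).mul_left C
  have hbd : ∀ n k, ‖x n (RMZero.coeff p k)‖ * s ^ k ≤ C * (‖RMZero.coeff p k‖ * s ^ k) :=
    fun n k => by
      rw [← mul_assoc]
      gcongr
      exact (x n).le_of_opNorm_le (hC' n) _
  have hlim : Tendsto (fun n => ∑' k, ‖x n (RMZero.coeff p k)‖ * s ^ k) atTop (𝓝 0) := by
    have h := tendsto_tsum_of_dominated_convergence (𝓕 := atTop)
      (f := fun n k => ‖x n (RMZero.coeff p k)‖ * s ^ k) (g := fun _ => (0 : ℝ)) hsum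
      (fun k => by
        have h1 : Tendsto (fun n => x n (RMZero.coeff p k)) atTop (𝓝 0) :=
          ((WeakDual.eval_continuous (RMZero.coeff p k)).tendsto 0).comp hx0
        simpa using h1.norm.mul_const (s ^ k))
      (.of_forall fun n k => by
        rw [Real.norm_of_nonneg (by positivity)]
        exact hbd n k)
    simpa using h
  rw [Metric.tendstoUniformlyOn_iff]
  intro ε hε
  filter_upwards [hlim.eventually (gt_mem_nhds hε)] with n hn z hz
  have hz' := mem_ball_zero_iff.1 hz
  rw [Pi.zero_apply, dist_zero_left,
    ← (hasSum_bidualFun (x n) (mem_ball_zero_iff.2 (hz'.trans hs1))).tsum_eq]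
  refine (tsum_of_norm_bounded (Summable.of_nonneg_of_le (fun k => by positivity) (hbd n)
    hsum).hasSum fun k => ?_).trans_lt hn
  rw [norm_mul, norm_pow]
  gcongr

/-! ### The second adjoint as an operator into `A^p`. -/

lemma toBergman_bidualToRM_add (hp : p ≠ ∞) (m m' : StrongDual ℂ (StrongDual ℂ (RMZero p))) :
    (bidualToRM hp (m + m')).toBergman =
      (bidualToRM hp m).toBergman + (bidualToRM hp m').toBergman := by
  apply Subtype.ext
  rw [RM.coe_add]
  exact bidualFun_add m m'

lemma toBergman_bidualToRM_smul (hp : p ≠ ∞) (c : ℂ)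
    (m : StrongDual ℂ (StrongDual ℂ (RMZero p))) :
    (bidualToRM hp (c • m)).toBergman = c • (bidualToRM hp m).toBergman := by
  apply Subtype.ext
  rw [RM.coe_smul]
  exact bidualFun_smul c m

lemma norm_toBergman_bidualToRM_le (hp : p ≠ ∞) (m : StrongDual ℂ (StrongDual ℂ (RMZero p))) :
    ‖(bidualToRM hp m).toBergman‖ ≤ 1 * ‖m‖ := by
  rw [one_mul]
  exact (RM.norm_toBergman_le (bidualToRM hp m)).trans (norm_bidualToRM_le hp m)

lemma isLinearMap_toBergman_bidualToRM (hp : p ≠ ∞) :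
    IsLinearMap ℂ fun m : StrongDual ℂ (StrongDual ℂ (RMZero p)) => (bidualToRM hp m).toBergman where
  map_add := toBergman_bidualToRM_add hp
  map_smul c m := Eq.trans (toBergman_bidualToRM_smul hp c m) rfl

/-- The second adjoint of the inclusion `RM(p, 0) → A^p`, with values in `A^p`. -/
noncomputable def bidualToBergman (hp : p ≠ ∞) :
    StrongDual ℂ (StrongDual ℂ (RMZero p)) →L[ℂ] Bergman p :=
  LinearMap.mkContinuous (IsLinearMap.mk' (fun m => (bidualToRM hp m).toBergman)
    (isLinearMap_toBergman_bidualToRM hp)) 1 (norm_toBergman_bidualToRM_le hp)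

end

/-- `Φ` is the second adjoint `I**` of the inclusion `I : RM(p, 0) → A^p`, read with values in `A^p`
through the canonical embedding of `A^p` into its bidual. -/
theorem mainTheorem7 (p : ℝ≥0∞) [Fact (1 ≤ p)] (hp : 1 < p) (hp' : p < ∞) :
    ∃ Φ : StrongDual ℂ (StrongDual ℂ (RMZero p)) →L[ℂ] Bergman p,
      (∀ m, NormedSpace.inclusionInDoubleDual ℂ (Bergman p) (Φ m) =
        banachAdjoint (banachAdjoint (inclRMZero p)) m) ∧
      Function.Injective Φ ∧
      range (fun m => (Φ m : ℂ → ℂ)) = range (fun f : RM p ∞ => (f : ℂ → ℂ)) ∧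
      (∀ m, ∀ f : RM p ∞, (f : ℂ → ℂ) = Φ m → ‖f‖ = ‖m‖) ∧
      ∀ x : ℕ → StrongDual ℂ (StrongDual ℂ (RMZero p)),
        Bornology.IsBounded (range x) →
        Tendsto (fun n => StrongDual.toWeakDual (x n)) atTop (𝓝 0) →
        ∀ K ⊆ Metric.ball (0 : ℂ) 1, IsCompact K →
          TendstoUniformlyOn (fun n => (Φ (x n) : ℂ → ℂ)) 0 atTop K := by
  have hval : ∀ m, (bidualToBergman hp'.ne m : ℂ → ℂ) = (bidualToRM hp'.ne m).1 := fun _ => rfl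
  refine ⟨bidualToBergman hp'.ne, fun m => ?_, ?_, ?_, fun m f hf => ?_,
    fun x hx hx0 K hK hKc => ?_⟩
  · ext φ
    exact apply_toBergman_bidualToRM hp hp'.ne m φ
  · refine (injective_iff_map_eq_zero _).2 fun m hm => ?_
    have h1 : bidualToRM hp'.ne m = 0 :=
      Subtype.ext ((hval m).symm.trans (congrArg (fun g : Bergman p => (g : ℂ → ℂ)) hm))
    have h2 : ‖m‖ = 0 := by rw [← norm_bidualToRM hp hp'.ne m, h1, norm_zero]
    ext φ
    exact norm_le_zero_iff.1 ((m.le_opNorm φ).trans_eq (by rw [h2, zero_mul]))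
  · refine Subset.antisymm ?_ ?_
    · rintro _ ⟨m, rfl⟩
      exact ⟨bidualToRM hp'.ne m, rfl⟩
    · rintro _ ⟨f, rfl⟩
      obtain ⟨m, hm⟩ := exists_bidualFun_eq hp'.ne f
      exact ⟨m, hm⟩
  · rw [← norm_bidualToRM hp hp'.ne m]
    exact congrArg norm (Subtype.ext (hf.trans (hval m)))
  · obtain ⟨s, hs1, hs⟩ := exists_lt_subset_ball hKc.isClosed hK
    -- The radius `s` may be negative when `K` is empty, hence `max s 0`.
    exact (tendstoUniformlyOn_bidualFun hx hx0 (le_max_right s 0)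
      (max_lt hs1 one_pos)).mono (hs.trans (Metric.ball_subset_ball (le_max_left s 0)))
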